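/- Let $\lambda_T,P_T,C_T,\alpha_T,R_B>0$, $G_M,G_m\ge 0$, $0\le\theta_a\le 2\pi$, $0\le\theta_d\le\pi$, let $m_T\ge 1$ be an integer, and let $p_M=\frac{\theta_a}{2\pi}\cdot\frac{\theta_d}{\pi}$, $p_m=1-p_M$. Let the mmWave base stations (TBSs) form a homogeneous Poisson point process $\Phi_T$ of density $\lambda_T$ in $\mathbb R^2$, let the typical user be at the origin, let $x_{T,0}$ be the (a.s. unique) point of $\Phi_T$ nearest to the origin, and $R_{T,0}=|x_{T,0}|$. The other points $x_{T,i}$, $i\ge 1$, have distances $R_{T,i}=|x_{T,i}|$ and carry independent marks: fading gains $H_{T,i}$ that are i.i.d. with the Gamma law of shape $m_T$ and scale $1/m_T$ (Nakagami-$m$ fading), and beamforming gains $G_i$ that are i.i.d. with $\mathbb P(G_i=G_M)=p_M$, $\mathbb P(G_i=G_m)=p_m$ (if $G_M=G_m$ the gain is constant); the points, the fading gains and the beamforming gains are mutually independent. The interference is $$I_T=\sum_{i\ge 1,\;R_{T,i}\le R_B}G_iP_TC_TR_{T,i}^{-\alpha_T}H_{T,i}.$$ Then for every $s\ge 0$ and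 every $\sigma$-algebra $\mathcal A$ that is independent of all of these random variables (the trivial one, or for instance the one generated by another tier of base stations, which together with $R_{T,0}$ decides to which tier the user is associated), the conditional Laplace transform $L_{I_T}(s)=\mathbb E\big[e^{-sI_T}\,\big|\,\mathcal A,R_{T,0}\big]$ satisfies, almost surely on $\{R_{T,0}\le R_B\}$, $$L_{I_T}(s)=\exp\Bigg[\frac{-2\pi\lambda_T}{\alpha_T}\sum_{j\in\{M,m\}}\sum_{i=1}^{m_T}p_j\binom{m_T}{i}\Big(\frac{sP_TC_TG_j}{m_T}\Big)^{\frac{2}{\alpha_T}}(-1)^{\frac{2}{\alpha_T}-i+1}\Big(B\big(t_{j,u};i-\tfrac{2}{\alpha_T},1-m_T\big)-B\big(t_{j,l};i-\tfrac{2}{\alpha_T},1-m_T\big)\Big)\Bigg],$$ where $t_{j,l}=-\frac{sP_TC_TG_j}{m_TR_{T,0}^{\alpha_T}}$, $t_{j,u}=-\frac{sP_TC_TG_j}{m_TR_B^{\alpha_T}}$, all powers are principal, so that $(-1)^x=e^{i\pi x}$ (here $i$ is the imaginary unit), and terms with $sG_j=0$ are $0$. Here $B(z;a,b)=\int_0^z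 t^{a-1}(1-t)^{b-1}\,dt$ is the incomplete Beta function, continued analytically in $a$ to $a\ne 0,-1,-2,\dots$ by $a\,B(z;a,b)=z^a(1-z)^b+(a+b)\,B(z;a+1,b)$; this is defined at all the arguments above if $2/\alpha_T$ is not a positive integer (in particular if $\alpha_T>2$). For every $\alpha_T>0$, including the case where $2/\alpha_T$ is a positive integer, the formula holds if the difference $B(t_{j,u};a,b)-B(t_{j,l};a,b)$ is read as the generalized incomplete Beta function $\int_{t_{j,l}}^{t_{j,u}}t^{a-1}(1-t)^{b-1}\,dt$. -/

import Mathlib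

open MeasureTheory ProbabilityTheory
open scoped ENNReal NNReal

noncomputable section

namespace MmWave

/-! ### Poisson point processes -/

/-- The random measure `Φ` on `E` (defined on the probability space `(Ω, μ)`) is a Poisson point
process with intensity measure `ν`: the number of points in a measurable set `B` of finite
intensity has the Poisson law with mean `ν B`, and the numbers of points in finitely many pairwise
disjoint such sets are independent. -/
structure IsPoissonProcess {Ω E : Type*} [MeasurableSpace Ω] [MeasurableSpace E]
    (Φ : Ω → Measure E) (ν : Measure E) (μ : Measure Ω) : Prop where
  law : ∀ B : Set E, MeasurableSet B → ν B < ∞ →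
    HasLaw (fun ω => Φ ω B)
      ((poissonMeasure (ν B).toNNReal).map (fun n : ℕ => (n : ℝ≥0∞))) μ
  indep : ∀ (n : ℕ) (B : Fin n → Set E), (∀ i, MeasurableSet (B i)) → (∀ i, ν (B i) < ∞) →
    Pairwise (fun i j => Disjoint (B i) (B j)) →
    iIndepFun (fun (i : Fin n) (ω : Ω) => Φ ω (B i)) μ

/-- The counting measure `∑ᵢ δ_{Xᵢ}` of a random sequence of points. -/
def countingMeasure {Ω E : Type*} [MeasurableSpace E] (X : ℕ → Ω → E) (ω : Ω) : Measure E :=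
  Measure.sum (fun i => Measure.dirac (X i ω))

/-! ### The mmWave tier -/

/-- The Euclidean plane. The typical user is at the origin. -/
abbrev Plane : Type := EuclideanSpace ℝ (Fin 2)

/-- The probability `p_M = (θ_a / 2π) (θ_d / π)` that an interferer is seen with its main lobe. -/
def mainLobeProb (θa θd : ℝ) : ℝ := θa / (2 * Real.pi) * (θd / Real.pi)

/-- The law of the beamforming gain of an interferer in the sectorized antenna model: `G_M` with
probability `p_M` and `G_m` with probability `1 - p_M`. -/
def beamGainLaw (θa θd GM Gm : ℝ) : Measure ℝ :=
  ENNReal.ofReal (mainLobeProb θa θd) • Measure.dirac GM +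
    ENNReal.ofReal (1 - mainLobeProb θa θd) • Measure.dirac Gm

/-- The mmWave tier. The base stations `X 0, X 1, …` form a homogeneous Poisson point process of
density `lam` in the plane, listed so that `X 0` is a nearest one to the origin (the serving
one); `G i` and `H i` are the beamforming gain and the fading of the interferer `X (i + 1)`. The
gains are i.i.d. with the sectorized law, the fadings are i.i.d. with the Gamma law of shape `m`
and scale `1 / m` (the second argument of `gammaMeasure` is the rate), and the point process, the
sequence of gains and the sequence of fadings are mutually independent. -/
structure IsMmWaveTier {Ω : Type*} [MeasurableSpace Ω] (μ : Measure Ω)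
    (X : ℕ → Ω → Plane) (G H : ℕ → Ω → ℝ) (lam θa θd GM Gm : ℝ) (m : ℕ) : Prop where
  measurable_X : ∀ i, Measurable (X i)
  measurable_G : ∀ i, Measurable (G i)
  measurable_H : ∀ i, Measurable (H i)
  poisson : IsPoissonProcess (countingMeasure X) (ENNReal.ofReal lam • volume) μ
  nearest : ∀ᵐ ω ∂μ, ∀ i, ‖X 0 ω‖ ≤ ‖X i ω‖
  law_G : ∀ i, HasLaw (G i) (beamGainLaw θa θd GM Gm) μ
  law_H : ∀ i, HasLaw (H i) (gammaMeasure m m) μ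
  iIndep_G : iIndepFun G μ
  iIndep_H : iIndepFun H μ
  indep_G_H : IndepFun (fun ω i => G i ω) (fun ω i => H i ω) μ
  indep_X_marks : IndepFun (fun ω i => X i ω)
    (fun ω => ((fun i => G i ω, fun i => H i ω) : (ℕ → ℝ) × (ℕ → ℝ))) μ

/-- The σ-algebra generated by the mmWave tier. -/
abbrev tierSigma {Ω : Type*} (X : ℕ → Ω → Plane) (G H : ℕ → Ω → ℝ) : MeasurableSpace Ω :=
  MeasurableSpace.comap
    (fun ω => ((fun i => X i ω, fun i => G i ω, fun i => H i ω) :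
      (ℕ → Plane) × (ℕ → ℝ) × (ℕ → ℝ))) inferInstance

/-- The distance `R_{T,0}` from the typical user to the nearest base station. -/
def servingDist {Ω : Type*} (X : ℕ → Ω → Plane) (ω : Ω) : ℝ := ‖X 0 ω‖

/-- The path loss `L_T(r) = 1(R_B - r) C_T r^(-α_T)` in the line-of-sight ball model. -/
def pathLoss (RB C α r : ℝ) : ℝ := if r ≤ RB then C * r ^ (-α) else 0

/-- The interference `I_T`, the sum of `G_i P_T L_T(R_{T,i}) H_{T,i}` over all base stations but
the serving one. Almost surely only finitely many terms are nonzero. -/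
def interference {Ω : Type*} (X : ℕ → Ω → Plane) (G H : ℕ → Ω → ℝ) (P C α RB : ℝ) (ω : Ω) : ℝ :=
  ∑' i : ℕ, G i ω * P * pathLoss RB C α ‖X (i + 1) ω‖ * H i ω

/-! ### The incomplete Beta function -/

/-- `n`-fold use of the relation
`a B(z; a, b) = z^a (1 - z)^b + (a + b) B(z; a + 1, b)`, starting from the integral
`B(z; a, b) = ∫₀^z t^(a-1) (1-t)^(b-1) dt` along the segment from `0` to `z`, which converges
for `Re a > 0`. Powers are principal. -/
def incBetaAux (z b : ℂ) : ℕ → ℂ → ℂ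
  | 0, a => ∫ u in (0 : ℝ)..1, z * (u * z) ^ (a - 1) * (1 - u * z) ^ (b - 1)
  | n + 1, a => (z ^ a * (1 - z) ^ b + (a + b) * incBetaAux z b n (a + 1)) / a

/-- The incomplete Beta function `B(z; a, b)` for `z ∉ [1, ∞)` and `a ≠ 0, -1, -2, …`: the
integral `∫₀^z t^(a-1) (1-t)^(b-1) dt` if `Re a > 0` (no shift is made then), and its analytic
continuation in `a` otherwise (the number of shifts is the least `n` with `Re a + n > 0`). -/
def incBeta (z a b : ℂ) : ℂ := incBetaAux z b ⌊1 - a.re⌋₊ a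

/-- The generalized incomplete Beta function
`B(x, y; a, b) = ∫_x^y t^(a-1) (1-t)^(b-1) dt` with real end points and principal powers. -/
def genIncBeta (x y : ℝ) (a b : ℂ) : ℂ :=
  ∫ t in x..y, (t : ℂ) ^ (a - 1) * (1 - (t : ℂ)) ^ (b - 1)

/-! ### The closed form -/

/-- The probability `p_j` of the two lobes: `true` is the main lobe `M`, `false` the side
lobe `m`. -/
def lobeProb (θa θd : ℝ) (j : Bool) : ℝ :=
  if j then mainLobeProb θa θd else 1 - mainLobeProb θa θd

/-- The constant `s P_T C_T G_j / m_T`. -/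
def lobeConst (s P C GM Gm : ℝ) (m : ℕ) (j : Bool) : ℝ :=
  s * P * C * (if j then GM else Gm) / m

/-- The point `t_j = -s P_T C_T G_j / (m_T r^α_T)`: it is `t_{j,l}` for `r = R_{T,0}` and `t_{j,u}`
for `r = R_B`. -/
def betaPoint (s P C GM Gm α : ℝ) (m : ℕ) (r : ℝ) (j : Bool) : ℝ :=
  -(lobeConst s P C GM Gm m j / r ^ α)

/-- The exponent in the closed form, with `D j i` in the place of the difference
`B(t_{j,u}; i - 2/α, 1 - m) - B(t_{j,l}; i - 2/α, 1 - m)`; `(-1)^x = exp(iπx)` is the principal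
power. -/
def laplaceExponent (lam θa θd GM Gm P C α s : ℝ) (m : ℕ) (D : Bool → ℕ → ℂ) : ℂ :=
  ((-2 * Real.pi * lam / α : ℝ) : ℂ) * ∑ j : Bool, ∑ i ∈ Finset.Icc 1 m,
    (lobeProb θa θd j : ℂ) * (m.choose i : ℂ) *
      ((lobeConst s P C GM Gm m j ^ (2 / α) : ℝ) : ℂ) *
      (-1 : ℂ) ^ ((2 / α - i + 1 : ℝ) : ℂ) * D j i

/-- The conditional Laplace transform `E[exp(-s I_T) | 𝒜, R_{T,0}]` of the interference. -/
def condLaplace {Ω : Type*} {mΩ : MeasurableSpace Ω} (μ : Measure Ω) (𝒜 : MeasurableSpace Ω)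
    (X : ℕ → Ω → Plane) (G H : ℕ → Ω → ℝ) (P C α RB s : ℝ) : Ω → ℝ :=
  condExp (𝒜 ⊔ MeasurableSpace.comap (servingDist X) inferInstance) μ
    (fun ω => Real.exp (-s * interference X G H P C α RB ω))

end MmWave

end

/-! Given the distance `R` of the nearest point, the remaining points form a Poisson process of the
same intensity outside the disc of radius `R`. A product of weights `φ ‖x‖` over them therefore has
conditional mean `exp (-∫_{‖x‖ > R} (1 - φ ‖x‖))`. Taking for `φ` the factor of `exp (-s I)` due to
one interferer, averaged over its marks, gives the conditional Laplace transform.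

The conditional mean is obtained without Palm calculus, from the generating functional
`IsPoissonProcess.integral_tprod` alone (`setIntegral_tprod_succ`). Let `t` be the intensity of the
annulus between radii `a` and `b`. On `{a < R ≤ b}` the product over the other points equals the
product over all points of the weight replaced by `1` within `b`, unless the annulus holds two
points, which has probability at most `t ^ 2`. The mean of the modified product is exact, and moving
the defect integral from `b` to `R` costs another `t ^ 2`. Thus the two sides of the claim, as
functions of the squared radius, differ by a function with quadratically small increments, and such
a function is constant.

The marks are integrated out by Fubini on finite products (`integral_mul_prod`), and a further
independent σ-algebra factors out (`setIntegral_inter_eq_mul`, with a π-λ argument).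

For the exponent, the Gamma law gives `φ r = ∑ p_j (1 + c_j r^(-α))^(-m)`. The numerator of `1 - (1
+ v)^(-m) = ((1 + v)^m - 1) / (1 + v)^m` is expanded binomially, and `t = -c_j r^(-α)` turns each
term into an integral of `(-t)^(i - 2/α - 1) (1 - t)^(-m)` on the negative axis
(`integral_pathLoss_pow`). The power of `-1` cancels the phase of the principal power of `t`.
Differences of continued incomplete Beta functions are the same integrals because both obey one
recurrence in `a` (`incBetaAux_sub_eq`). -/

noncomputable section

namespace MmWave

open Filter Topology

/-! ### The generating functional of a Poisson process -/

section PoissonProcess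

variable {Ω E : Type*} [MeasurableSpace Ω] [MeasurableSpace E] {μ : Measure Ω}

omit [MeasurableSpace Ω] in
lemma countingMeasure_apply (X : ℕ → Ω → E) (ω : Ω) {B : Set E} (hB : MeasurableSet B) :
    countingMeasure X ω B = ({i | X i ω ∈ B} : Set ℕ).encard := by
  rw [countingMeasure, Measure.sum_apply _ hB, ← ENNReal.tsum_set_one,
    tsum_subtype ({i | X i ω ∈ B} : Set ℕ) (fun _ => (1 : ℝ≥0∞))]
  refine tsum_congr fun i => ?_
  rw [Measure.dirac_apply' _ hB]
  by_cases h : X i ω ∈ B <;> simp [h]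

/-- No convergence is needed, since a product that is not multipliable has the default value `1`. -/
lemma tprod_mem_Icc {u : ℕ → ℝ} (hu : ∀ i, u i ∈ Set.Icc (0 : ℝ) 1) :
    ∏' i, u i ∈ Set.Icc (0 : ℝ) 1 := by
  by_cases h : Multipliable u
  · exact isClosed_Icc.mem_of_tendsto h.hasProd (Eventually.of_forall fun s =>
      ⟨Finset.prod_nonneg fun i _ => (hu i).1,
        Finset.prod_le_one (fun i _ => (hu i).1) fun i _ => (hu i).2⟩)
  · rw [tprod_eq_one_of_not_multipliable h]
    simp

/-- The probability generating function of the Poisson law. -/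
lemma integral_pow_of_hasLaw_poisson {N : Ω → ℝ≥0∞} {t : ℝ≥0}
    (hN : HasLaw N ((poissonMeasure t).map (fun n : ℕ => (n : ℝ≥0∞))) μ) (c : ℝ) :
    ∫ ω, c ^ ⌊(N ω).toReal⌋₊ ∂μ = Real.exp (-((1 - c) * t)) := by
  have hmeas : Measurable (fun x : ℝ≥0∞ => c ^ ⌊x.toReal⌋₊) :=
    (measurable_of_countable (fun n : ℕ => c ^ n)).comp
      (Nat.measurable_floor.comp ENNReal.measurable_toReal)
  have h := hN.integral_comp (f := fun x : ℝ≥0∞ => c ^ ⌊x.toReal⌋₊) hmeas.aestronglyMeasurable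
  rw [Function.comp_def] at h
  rw [h, integral_map (measurable_of_countable _).aemeasurable hmeas.aestronglyMeasurable,
    integral_poissonMeasure]
  have h2 : ∀ n : ℕ, (Real.exp (-t) * (t : ℝ) ^ n / n.factorial) • c ^ ⌊((n : ℝ≥0∞)).toReal⌋₊
      = Real.exp (-t) * ((c * t) ^ n / n.factorial) := by
    intro n
    simp only [ENNReal.toReal_natCast, Nat.floor_natCast, smul_eq_mul, mul_pow]
    ring
  simp_rw [h2]
  rw [tsum_mul_left, (NormedSpace.expSeries_div_hasSum_exp (c * t : ℝ)).tsum_eq,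
    ← Real.exp_eq_exp_ℝ, ← Real.exp_add]
  congr 1
  ring

namespace IsPoissonProcess

variable {ν : Measure E}

/-- Independence over disjoint cells reduces this to the generating function of a single Poisson
count. -/
lemma integral_prod_pow {Φ : Ω → Measure E} (h : IsPoissonProcess Φ ν μ) {n : ℕ}
    (B : Fin n → Set E) (hB : ∀ i, MeasurableSet (B i)) (hν : ∀ i, ν (B i) < ∞)
    (hd : Pairwise fun i j => Disjoint (B i) (B j)) (c : Fin n → ℝ) :
    ∫ ω, ∏ i, c i ^ ⌊(Φ ω (B i)).toReal⌋₊ ∂μ = Real.exp (-∑ i, (1 - c i) * (ν (B i)).toReal) := by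
  have hmeas : ∀ c : ℝ, Measurable (fun x : ℝ≥0∞ => c ^ ⌊x.toReal⌋₊) := fun c =>
    (measurable_of_countable (fun n : ℕ => c ^ n)).comp
      (Nat.measurable_floor.comp ENNReal.measurable_toReal)
  have := (h.indep n B hB hν hd).integral_fun_prod_comp
    (f := fun i (x : ℝ≥0∞) => c i ^ ⌊x.toReal⌋₊)
    (fun i => (h.law (B i) (hB i) (hν i)).aemeasurable)
    (fun i => (hmeas (c i)).aestronglyMeasurable)
  rw [this, ← Finset.sum_neg_distrib, Real.exp_sum]
  exact Finset.prod_congr rfl fun i _ =>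
    integral_pow_of_hasLaw_poisson (h.law (B i) (hB i) (hν i)) (c i)

variable {X : ℕ → Ω → E}

lemma ae_finite (h : IsPoissonProcess (countingMeasure X) ν μ) {B : Set E}
    (hB : MeasurableSet B) (hν : ν B < ∞) : ∀ᵐ ω ∂μ, {i | X i ω ∈ B}.Finite := by
  have h1 : ∀ᵐ x ∂((poissonMeasure (ν B).toNNReal).map (fun n : ℕ => (n : ℝ≥0∞))), x ≠ ∞ := by
    have hs : MeasurableSet {x : ℝ≥0∞ | x ≠ ∞} := (measurableSet_singleton ∞).compl
    rw [ae_map_iff (measurable_of_countable _).aemeasurable hs]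
    exact Eventually.of_forall fun n => ENNReal.natCast_ne_top n
  rw [← (h.law B hB hν).map_eq] at h1
  filter_upwards [ae_of_ae_map (h.law B hB hν).aemeasurable h1] with ω hω
  rw [countingMeasure_apply X ω hB] at hω
  exact Set.encard_ne_top_iff.1 (by simpa using hω)

omit [MeasurableSpace Ω] in
-- Grouping the points in `B` by the value of `f` turns the product over points into a product over
-- the finitely many level sets.
lemma prod_eq_prod_pow (ω : Ω) {B : Set E} (hB : MeasurableSet B) (f : SimpleFunc E ℝ)
    (hfin : {i | X i ω ∈ B}.Finite) :
    ∏' i, B.mulIndicator f (X i ω) =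
      ∏ c : f.range, (c : ℝ) ^ ⌊(countingMeasure X ω (B ∩ f ⁻¹' {(c : ℝ)})).toReal⌋₊ := by
  classical
  rw [tprod_eq_prod (s := hfin.toFinset) (fun i hi => by
    rw [Set.mulIndicator_of_notMem]; simpa using hi)]
  rw [Finset.prod_congr rfl (g := fun i => f (X i ω)) (fun i hi => by
    rw [Set.mulIndicator_of_mem]; simpa using hi)]
  rw [← Finset.prod_fiberwise_of_maps_to (t := f.range) (g := fun i => f (X i ω))
    (fun i _ => f.mem_range_self _), ← Finset.prod_coe_sort]
  refine Finset.prod_congr rfl fun c _ => ?_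
  rw [Finset.prod_congr rfl (g := fun _ => (c : ℝ)) (fun i hi => (Finset.mem_filter.1 hi).2),
    Finset.prod_const]
  congr 1
  rw [countingMeasure_apply X ω (hB.inter (f.measurableSet_fiber _))]
  have : ({i | X i ω ∈ B ∩ f ⁻¹' {(c : ℝ)}} : Set ℕ)
      = ((hfin.toFinset.filter fun i => f (X i ω) = c : Finset ℕ) : Set ℕ) := by
    ext i; simp
  rw [this, Set.encard_coe_eq_coe_finsetCard]
  simp

/-- The level sets of `f` within `B` are disjoint, so the joint generating function of their counts
applies, and the resulting exponent is the integral of a simple function. -/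
lemma integral_tprod_simpleFunc (h : IsPoissonProcess (countingMeasure X) ν μ) {B : Set E}
    (hB : MeasurableSet B) (hν : ν B < ∞) (f : SimpleFunc E ℝ) :
    ∫ ω, ∏' i, B.mulIndicator f (X i ω) ∂μ = Real.exp (-∫ x in B, (1 - f x) ∂ν) := by
  have hfinite : IsFiniteMeasure (ν.restrict B) := ⟨by simpa using hν⟩
  rw [integral_congr_ae ((h.ae_finite hB hν).mono fun ω hω => prod_eq_prod_pow ω hB f hω)]
  let e := f.range.equivFin.symm
  have key := h.integral_prod_pow (fun k => B ∩ f ⁻¹' {(e k : ℝ)})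
    (fun k => hB.inter (f.measurableSet_fiber _))
    (fun k => (measure_mono Set.inter_subset_left).trans_lt hν)
    (fun i j hij => by
      refine Set.disjoint_left.2 fun x hx hx' => hij ?_
      apply e.injective
      exact Subtype.ext (hx.2.symm.trans hx'.2))
    (fun k => (e k : ℝ))
  have e1 : ∀ ω, ∏ c : f.range, (c : ℝ) ^ ⌊(countingMeasure X ω (B ∩ f ⁻¹' {(c : ℝ)})).toReal⌋₊
      = ∏ k, (e k : ℝ) ^ ⌊(countingMeasure X ω (B ∩ f ⁻¹' {(e k : ℝ)})).toReal⌋₊ := fun ω =>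
    (Equiv.prod_comp e (fun c : f.range =>
      (c : ℝ) ^ ⌊(countingMeasure X ω (B ∩ f ⁻¹' {(c : ℝ)})).toReal⌋₊)).symm
  simp_rw [e1]
  rw [key, Equiv.sum_comp e (fun c : f.range => (1 - (c : ℝ)) * (ν (B ∩ f ⁻¹' {(c : ℝ)})).toReal)]
  congr 2
  have e2 : ∑ c ∈ f.range, (ν.restrict B).real (f ⁻¹' {c}) = (ν.restrict B).real Set.univ := by
    rw [sum_measureReal_preimage_singleton _ fun c _ => f.measurableSet_fiber c, f.coe_range,
      Set.preimage_range]
  rw [integral_sub (integrable_const _) (SimpleFunc.integrable_of_isFiniteMeasure f),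
    ← SimpleFunc.integral_eq_integral f (SimpleFunc.integrable_of_isFiniteMeasure _),
    SimpleFunc.integral_eq, integral_const, ← e2, smul_eq_mul, mul_one, ← Finset.sum_sub_distrib,
    Finset.sum_coe_sort f.range fun c => (1 - c) * (ν (B ∩ f ⁻¹' {c})).toReal]
  refine Finset.sum_congr rfl fun c _ => ?_
  rw [measureReal_def, Measure.restrict_apply (f.measurableSet_fiber _), smul_eq_mul,
    Set.inter_comm]
  ring

/-- Simple functions with values in `[0, 1]` approximate `f` pointwise; everything is bounded by
`1`, so both sides pass to the limit. -/
lemma integral_tprod_mulIndicator [IsProbabilityMeasure μ] (hX : ∀ i, Measurable (X i))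
    (h : IsPoissonProcess (countingMeasure X) ν μ) {B : Set E}
    (hB : MeasurableSet B) (hν : ν B < ∞) {f : E → ℝ} (hf : Measurable f)
    (hf01 : ∀ x, f x ∈ Set.Icc (0 : ℝ) 1) :
    ∫ ω, ∏' i, B.mulIndicator f (X i ω) ∂μ = Real.exp (-∫ x in B, (1 - f x) ∂ν) := by
  have hfinite : IsFiniteMeasure (ν.restrict B) := ⟨by simpa using hν⟩
  have h0 : (0 : ℝ) ∈ Set.Icc (0 : ℝ) 1 := by simp
  let F : ℕ → SimpleFunc E ℝ := fun n => SimpleFunc.approxOn f hf (Set.Icc 0 1) 0 h0 n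
  have hF01 : ∀ n x, F n x ∈ Set.Icc (0 : ℝ) 1 := fun n x => SimpleFunc.approxOn_mem hf h0 n x
  have hF : ∀ x, Tendsto (fun n => F n x) atTop (𝓝 (f x)) := fun x =>
    SimpleFunc.tendsto_approxOn hf h0 (subset_closure (hf01 x))
  have hI : ∀ {g : E → ℝ}, (∀ x, g x ∈ Set.Icc (0 : ℝ) 1) → ∀ x,
      B.mulIndicator g x ∈ Set.Icc (0 : ℝ) 1 := by
    intro g hg x
    by_cases hx : x ∈ B <;> simp only [hx, Set.mulIndicator_of_mem, Set.mulIndicator_of_notMem,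
      not_false_eq_true]
    · exact hg x
    · simp
  have hmi : ∀ {g : E → ℝ}, Measurable g → Measurable (B.mulIndicator g) := by
    classical
    intro g hg
    rw [← Set.piecewise_eq_mulIndicator]
    exact hg.piecewise hB measurable_const
  have hl : Tendsto (fun n => ∫ ω, ∏' i, B.mulIndicator (F n) (X i ω) ∂μ) atTop
      (𝓝 (∫ ω, ∏' i, B.mulIndicator f (X i ω) ∂μ)) := by
    refine tendsto_integral_of_dominated_convergence (fun _ => 1) (fun n => ?_)
      (integrable_const _) (fun n => Eventually.of_forall fun ω => ?_) ?_
    · exact (Measurable.tprod fun i =>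
        ((hmi (F n).measurable).comp (hX i))).aestronglyMeasurable
    · have := tprod_mem_Icc fun i => hI (hF01 n) (X i ω)
      rw [Real.norm_of_nonneg this.1]
      exact this.2
    -- Almost surely only finitely many points lie in `B`, so the infinite product is a fixed finite
    -- one and converges factor by factor.
    · filter_upwards [h.ae_finite hB hν] with ω hω
      have e : ∀ g : E → ℝ, ∏' i, B.mulIndicator g (X i ω)
          = ∏ i ∈ hω.toFinset, B.mulIndicator g (X i ω) := fun g =>
        tprod_eq_prod fun i hi => Set.mulIndicator_of_notMem (by simpa using hi) _
      simp_rw [e]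
      refine tendsto_finsetProd _ fun i hi => ?_
      have hi' : X i ω ∈ B := by simpa using hi
      simpa only [Set.mulIndicator_of_mem hi'] using hF (X i ω)
  have hr : Tendsto (fun n => ∫ x in B, (1 - F n x) ∂ν) atTop (𝓝 (∫ x in B, (1 - f x) ∂ν)) := by
    refine tendsto_integral_of_dominated_convergence (fun _ => 1) (fun n => ?_)
      (integrable_const _) (fun n => Eventually.of_forall fun x => ?_)
      (Eventually.of_forall fun x => (hF x).const_sub 1)
    · exact (measurable_const.sub (F n).measurable).aestronglyMeasurable
    · have := hF01 n x
      rw [Real.norm_of_nonneg (by linarith [this.2])]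
      linarith [this.1]
  refine tendsto_nhds_unique hl ?_
  simp_rw [h.integral_tprod_simpleFunc hB hν]
  exact (Real.continuous_exp.tendsto _).comp hr.neg

/-- The probability generating functional of a Poisson process. -/
lemma integral_tprod [IsProbabilityMeasure μ] (hX : ∀ i, Measurable (X i))
    (h : IsPoissonProcess (countingMeasure X) ν μ) {B : Set E}
    (hB : MeasurableSet B) (hν : ν B < ∞) {f : E → ℝ} (hf : Measurable f)
    (hf01 : ∀ x, f x ∈ Set.Icc (0 : ℝ) 1) (hf1 : ∀ x ∉ B, f x = 1) :
    ∫ ω, ∏' i, f (X i ω) ∂μ = Real.exp (-∫ x, (1 - f x) ∂ν) := by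
  have e : B.mulIndicator f = f := by
    rw [Set.mulIndicator_eq_self]
    exact Function.mulSupport_subset_iff'.2 hf1
  have := h.integral_tprod_mulIndicator hX hB hν hf hf01
  rw [e] at this
  rw [this, setIntegral_eq_integral_of_forall_compl_eq_zero fun x hx => by rw [hf1 x hx, sub_self]]

/-- The probability of at least two points in a set is at most the square of its intensity. -/
lemma measureReal_two_le [IsProbabilityMeasure μ] {Φ : Ω → Measure E}
    (h : IsPoissonProcess Φ ν μ) {B : Set E} (hB : MeasurableSet B) (hν : ν B < ∞) :
    μ.real {ω | 2 ≤ Φ ω B} ≤ (ν B).toReal ^ 2 := by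
  have hs : MeasurableSet {x : ℝ≥0∞ | 2 ≤ x} := measurableSet_Ici
  rw [(h.law B hB hν).measureReal_eq hs, map_measureReal_apply (measurable_of_countable _) hs]
  set t := (ν B).toNNReal
  have e : ((fun n : ℕ => (n : ℝ≥0∞)) ⁻¹' {x | 2 ≤ x}) = ({0} ∪ {1} : Set ℕ)ᶜ := by
    ext n
    simp only [Set.mem_preimage, Set.mem_ofPred_eq, Nat.ofNat_le_cast, Set.mem_compl_iff,
      Set.mem_union, Set.mem_singleton_iff]
    omega
  rw [e, probReal_compl_eq_one_sub (by measurability),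
    measureReal_union (by simp) (measurableSet_singleton _),
    poissonMeasure_real_singleton, poissonMeasure_real_singleton]
  have ht : (ν B).toReal = t := rfl
  -- The probability is `1 - (1 + t) e^(-t)`, and `e^(-t) ≥ 1 - t` bounds it by `1 - (1 + t)(1 - t)
  -- = t ^ 2`.
  have := Real.add_one_le_exp (-(t : ℝ))
  have h0 : (0 : ℝ) ≤ t := t.2
  rw [ht]
  simp only [pow_zero, mul_one, Nat.factorial_zero, Nat.cast_one, div_one, pow_one,
    Nat.factorial_one]
  nlinarith

end IsPoissonProcess
end PoissonProcess

/-- Quadratically small increments force the derivative to vanish everywhere. -/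
lemma eq_of_forall_abs_sub_le_sq {f : ℝ → ℝ} {K : ℝ}
    (h : ∀ s t, s ≤ t → |f t - f s| ≤ K * (t - s) ^ 2) (s t : ℝ) : f s = f t := by
  have hd : ∀ x, HasDerivAt f 0 x := by
    intro x
    have hO : (fun y => f y - f x) =O[𝓝 x] fun y => ‖y - x‖ ^ 2 := by
      refine Asymptotics.IsBigO.of_bound K (Eventually.of_forall fun y => ?_)
      rw [Real.norm_eq_abs, Real.norm_eq_abs, Real.norm_eq_abs, abs_pow, abs_abs, sq_abs]
      rcases le_total x y with hxy | hxy
      · exact h x y hxy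
      · rw [abs_sub_comm, ← neg_sub x y, neg_sq]
        exact h y x hxy
    have h1 := (hO.hasFDerivAt (by norm_num)).hasDerivAt
    simpa using h1
  exact is_const_of_deriv_eq_zero (fun x => (hd x).differentiableAt) (fun x => (hd x).deriv) s t

/-! ### Discs, annuli and radial weights in the plane -/

/-- The intensity measure of the base stations. -/
abbrev planeIntensity (lam : ℝ) : Measure Plane := ENNReal.ofReal lam • volume

lemma planeIntensity_closedBall_lt_top (lam r : ℝ) :
    planeIntensity lam (Metric.closedBall 0 r) < ∞ := by
  rw [Measure.smul_apply, smul_eq_mul]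
  exact ENNReal.mul_lt_top ENNReal.ofReal_lt_top measure_closedBall_lt_top

lemma planeIntensity_closedBall_toReal {lam r : ℝ} (hlam : 0 ≤ lam) (hr : 0 ≤ r) :
    (planeIntensity lam (Metric.closedBall 0 r)).toReal = lam * Real.pi * r ^ 2 := by
  rw [Measure.smul_apply, smul_eq_mul, EuclideanSpace.volume_closedBall_fin_two, ENNReal.toReal_mul,
    ENNReal.toReal_mul, ENNReal.toReal_pow, ENNReal.toReal_ofReal hlam, ENNReal.toReal_ofReal hr,
    ENNReal.toReal_ofReal Real.pi_pos.le]
  ring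

/-- The points whose distance from the origin lies in `(a, b]`. -/
def annulus (a b : ℝ) : Set Plane := {x | a < ‖x‖ ∧ ‖x‖ ≤ b}

lemma measurableSet_annulus (a b : ℝ) : MeasurableSet (annulus a b) :=
  (measurableSet_lt measurable_const measurable_norm).inter
    (measurableSet_le measurable_norm measurable_const)

lemma measurableSet_lt_norm (a : ℝ) : MeasurableSet {x : Plane | a < ‖x‖} :=
  measurableSet_lt measurable_const measurable_norm

lemma planeIntensity_annulus_lt_top (lam a b : ℝ) : planeIntensity lam (annulus a b) < ∞ :=
  (measure_mono fun x hx => by simpa using hx.2).trans_lt (planeIntensity_closedBall_lt_top lam b)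

lemma planeIntensity_annulus_toReal {lam a b : ℝ} (hlam : 0 ≤ lam) (ha : 0 ≤ a) (hab : a ≤ b) :
    (planeIntensity lam (annulus a b)).toReal = lam * Real.pi * (b ^ 2 - a ^ 2) := by
  have e : Metric.closedBall (0 : Plane) b = Metric.closedBall 0 a ∪ annulus a b := by
    ext x
    simp only [Metric.mem_closedBall, dist_zero_right, annulus, Set.mem_union, Set.mem_ofPred_eq]
    constructor
    · intro h
      rcases le_or_gt ‖x‖ a with h1 | h1
      · exact Or.inl h1
      · exact Or.inr ⟨h1, h⟩
    · rintro (h | h)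
      · exact h.trans hab
      · exact h.2
  have hd : Disjoint (Metric.closedBall (0 : Plane) a) (annulus a b) :=
    Set.disjoint_left.2 fun x hx hx' => by
      simp only [Metric.mem_closedBall, dist_zero_right] at hx
      exact absurd hx'.1 (not_lt.2 hx)
  have h := planeIntensity_closedBall_toReal hlam (ha.trans hab)
  rw [e, measure_union hd (measurableSet_annulus a b),
    ENNReal.toReal_add (planeIntensity_closedBall_lt_top lam a).ne
      (planeIntensity_annulus_lt_top lam a b).ne, planeIntensity_closedBall_toReal hlam ha] at h
  linarith

/-- A radial weight `φ` with values in `[0, 1]` that is `1` beyond the distance `RB`. -/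
structure IsRadialWeight (φ : ℝ → ℝ) (RB : ℝ) : Prop where
  measurable : Measurable φ
  mem_Icc : ∀ r, φ r ∈ Set.Icc (0 : ℝ) 1
  eq_one : ∀ r, RB < r → φ r = 1

lemma isRadialWeight_one (RB : ℝ) : IsRadialWeight (fun _ => 1) RB :=
  ⟨measurable_const, fun _ => by simp, fun _ _ => rfl⟩

/-- The weight `φ` cut off to `1` within the distance `b`. -/
def cutWeight (φ : ℝ → ℝ) (b r : ℝ) : ℝ := if r ≤ b then 1 else φ r

lemma cutWeight_of_le (φ : ℝ → ℝ) {b r : ℝ} (h : r ≤ b) : cutWeight φ b r = 1 := if_pos h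

lemma cutWeight_of_lt (φ : ℝ → ℝ) {b r : ℝ} (h : b < r) : cutWeight φ b r = φ r :=
  if_neg (not_le.2 h)

/-- The integral of `1 - φ` over the points farther than `r` from the origin. -/
def outerDefect (lam : ℝ) (φ : ℝ → ℝ) (r : ℝ) : ℝ :=
  ∫ x in {x : Plane | r < ‖x‖}, (1 - φ ‖x‖) ∂(planeIntensity lam)

namespace IsRadialWeight

variable {φ : ℝ → ℝ} {RB : ℝ}

lemma cut (h : IsRadialWeight φ RB) (b : ℝ) : IsRadialWeight (cutWeight φ b) RB where
  measurable := Measurable.ite measurableSet_Iic measurable_const h.measurable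
  mem_Icc r := by
    unfold cutWeight
    split_ifs
    · simp
    · exact h.mem_Icc r
  eq_one r hr := by
    unfold cutWeight
    split_ifs
    · rfl
    · exact h.eq_one r hr

lemma integrable (h : IsRadialWeight φ RB) (lam : ℝ) :
    Integrable (fun x : Plane => 1 - φ ‖x‖) (planeIntensity lam) := by
  have hm : Measurable fun x : Plane => 1 - φ ‖x‖ :=
    measurable_const.sub (h.measurable.comp measurable_norm)
  have h1 : IntegrableOn (fun x : Plane => 1 - φ ‖x‖) (Metric.closedBall 0 RB)
      (planeIntensity lam) := by
    refine Measure.integrableOn_of_bounded (planeIntensity_closedBall_lt_top lam RB).ne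
      hm.aestronglyMeasurable (M := 1) (Eventually.of_forall fun x => ?_)
    have := h.mem_Icc ‖x‖
    rw [Real.norm_of_nonneg (by linarith [this.2])]
    linarith [this.1]
  refine (integrableOn_iff_integrable_of_support_subset fun x hx => ?_).1 h1
  by_contra hx'
  simp only [Metric.mem_closedBall, dist_zero_right, not_le] at hx'
  exact hx (by simp [h.eq_one _ hx'])

lemma outerDefect_nonneg (h : IsRadialWeight φ RB) (lam r : ℝ) : 0 ≤ outerDefect lam φ r :=
  integral_nonneg fun _ => sub_nonneg.2 (h.mem_Icc _).2

lemma outerDefect_eq_add (h : IsRadialWeight φ RB) (lam : ℝ) {a b : ℝ} (hab : a ≤ b) :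
    outerDefect lam φ a
      = (∫ x in annulus a b, (1 - φ ‖x‖) ∂(planeIntensity lam)) + outerDefect lam φ b := by
  have e : {x : Plane | a < ‖x‖} = annulus a b ∪ {x | b < ‖x‖} := by
    ext x
    simp only [annulus, Set.mem_union, Set.mem_ofPred_eq]
    constructor
    · intro h
      rcases le_or_gt ‖x‖ b with h1 | h1
      · exact Or.inl ⟨h, h1⟩
      · exact Or.inr h1
    · rintro (h | h)
      · exact h.1
      · exact hab.trans_lt h
  unfold outerDefect
  rw [e, setIntegral_union _ (measurableSet_lt_norm b) (h.integrable lam).integrableOn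
    (h.integrable lam).integrableOn]
  exact Set.disjoint_left.2 fun x hx hx' => absurd hx' (not_lt.2 hx.2)

lemma outerDefect_anti (h : IsRadialWeight φ RB) (lam : ℝ) : Antitone (outerDefect lam φ) := by
  intro a b hab
  rw [h.outerDefect_eq_add lam hab]
  have : 0 ≤ ∫ x in annulus a b, (1 - φ ‖x‖) ∂(planeIntensity lam) :=
    integral_nonneg fun x => sub_nonneg.2 (h.mem_Icc _).2
  linarith

lemma outerDefect_sub_le (h : IsRadialWeight φ RB) (lam : ℝ) {a b : ℝ} (hab : a ≤ b) :
    outerDefect lam φ a - outerDefect lam φ b ≤ (planeIntensity lam (annulus a b)).toReal := by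
  rw [h.outerDefect_eq_add lam hab, add_sub_cancel_right]
  refine (le_abs_self _).trans ?_
  rw [← Real.norm_eq_abs]
  have := norm_setIntegral_le_of_norm_le_const (f := fun x : Plane => 1 - φ ‖x‖) (C := 1)
    (planeIntensity_annulus_lt_top lam a b) (fun x _ => by
      have := h.mem_Icc ‖x‖
      rw [Real.norm_of_nonneg (by linarith [this.2])]
      linarith [this.1])
  rwa [one_mul] at this

end IsRadialWeight

/-! ### Conditioning on the distance of the nearest point -/

/-- The base stations of a tier: a Poisson process listed with a nearest point first. -/
structure IsNearestListed {Ω : Type*} [MeasurableSpace Ω] (μ : Measure Ω) (X : ℕ → Ω → Plane)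
    (lam : ℝ) : Prop where
  measurable_X : ∀ i, Measurable (X i)
  poisson : IsPoissonProcess (countingMeasure X) (planeIntensity lam) μ
  nearest : ∀ᵐ ω ∂μ, ∀ i, ‖X 0 ω‖ ≤ ‖X i ω‖

namespace IsNearestListed

variable {Ω : Type*} [MeasurableSpace Ω] {μ : Measure Ω} [IsProbabilityMeasure μ]
  {X : ℕ → Ω → Plane} {lam : ℝ} {φ : ℝ → ℝ} {RB : ℝ}

omit [IsProbabilityMeasure μ] in
lemma measurable_servingDist (hX : IsNearestListed μ X lam) : Measurable (servingDist X) :=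
  (hX.measurable_X 0).norm

omit [IsProbabilityMeasure μ] in
lemma measurable_tprod (hX : IsNearestListed μ X lam) (hφ : Measurable φ) :
    Measurable fun ω => ∏' i, φ ‖X i ω‖ :=
  Measurable.tprod fun i => hφ.comp (hX.measurable_X i).norm

omit [IsProbabilityMeasure μ] in
lemma measurable_tprod_succ (hX : IsNearestListed μ X lam) (hφ : Measurable φ) :
    Measurable fun ω => ∏' i, φ ‖X (i + 1) ω‖ :=
  Measurable.tprod fun i => hφ.comp (hX.measurable_X (i + 1)).norm

/-- The generating functional is applied to a weight that vanishes on the disc of radius `a`: its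
product is zero as soon as the nearest point lies there. Since `a ≤ b`, the disc and the region
beyond `b` contribute separately to the exponent. -/
lemma integral_void_tprod (hX : IsNearestListed μ X lam) (hφ : IsRadialWeight φ RB) {a b : ℝ}
    (hab : a ≤ b) :
    ∫ ω in {ω | a < servingDist X ω}, ∏' i, cutWeight φ b ‖X i ω‖ ∂μ =
      Real.exp (-(planeIntensity lam (Metric.closedBall 0 a)).toReal)
        * Real.exp (-outerDefect lam φ b) := by
  classical
  let f : Plane → ℝ := (Metric.closedBall 0 a).piecewise 0 fun x => cutWeight φ b ‖x‖
  have hf : Measurable f := Measurable.piecewise measurableSet_closedBall measurable_const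
    ((hφ.cut b).measurable.comp measurable_norm)
  have hf01 : ∀ x, f x ∈ Set.Icc (0 : ℝ) 1 := by
    intro x
    by_cases hx : x ∈ Metric.closedBall (0 : Plane) a <;>
      simp only [f, hx, Set.piecewise_eq_of_mem, Set.piecewise_eq_of_notMem, not_false_eq_true]
    · simp
    · exact (hφ.cut b).mem_Icc _
  have hf1 : ∀ x ∉ Metric.closedBall (0 : Plane) (max a RB), f x = 1 := by
    intro x hx
    simp only [Metric.mem_closedBall, dist_zero_right, not_le, max_lt_iff] at hx
    have : x ∉ Metric.closedBall (0 : Plane) a := by simpa using hx.1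
    simp only [f, this, Set.piecewise_eq_of_notMem, not_false_eq_true]
    exact (hφ.cut b).eq_one _ hx.2
  have key := hX.poisson.integral_tprod hX.measurable_X measurableSet_closedBall
    (planeIntensity_closedBall_lt_top lam (max a RB)) hf hf01 hf1
  have hs : MeasurableSet {ω | a < servingDist X ω} :=
    measurableSet_lt measurable_const hX.measurable_servingDist
  rw [← integral_indicator hs]
  have e : ∀ᵐ ω ∂μ, Set.indicator {ω | a < servingDist X ω}
      (fun ω => ∏' i, cutWeight φ b ‖X i ω‖) ω = ∏' i, f (X i ω) := by
    filter_upwards [hX.nearest] with ω hω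
    by_cases h : a < servingDist X ω
    · rw [Set.indicator_of_mem (by exact h)]
      refine tprod_congr fun i => ?_
      have : X i ω ∉ Metric.closedBall (0 : Plane) a := by
        simpa using h.trans_le (hω i)
      simp only [f, this, Set.piecewise_eq_of_notMem, not_false_eq_true]
    · rw [Set.indicator_of_notMem (by exact h)]
      refine (tprod_of_exists_eq_zero ⟨0, ?_⟩).symm
      have : X 0 ω ∈ Metric.closedBall (0 : Plane) a := by
        simpa [servingDist] using h
      simp only [f, this, Set.piecewise_eq_of_mem, Pi.zero_apply]
  rw [integral_congr_ae e, key, ← Real.exp_add]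
  congr 1
  have e2 : ∀ x, 1 - f x = (Metric.closedBall (0 : Plane) a).indicator (fun _ => (1 : ℝ)) x
      + {x : Plane | b < ‖x‖}.indicator (fun x => 1 - φ ‖x‖) x := by
    intro x
    simp only [f, Set.piecewise, Set.indicator, cutWeight, Metric.mem_closedBall, dist_zero_right,
      Set.mem_ofPred_eq, Pi.zero_apply]
    split_ifs <;> linarith
  simp_rw [e2]
  rw [integral_add, integral_indicator measurableSet_closedBall,
    integral_indicator (measurableSet_lt_norm b), setIntegral_const, smul_eq_mul, mul_one,
    measureReal_def, outerDefect]
  · ring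
  · rw [integrable_indicator_iff measurableSet_closedBall]
    exact integrableOn_const (planeIntensity_closedBall_lt_top lam a).ne
  · exact (hφ.integrable lam).indicator (measurableSet_lt_norm b)

/-- The probability that there is no base station within the distance `a`. -/
lemma measureReal_lt_servingDist (hX : IsNearestListed μ X lam) (a : ℝ) :
    μ.real {ω | a < servingDist X ω} =
      Real.exp (-(planeIntensity lam (Metric.closedBall 0 a)).toReal) := by
  have h := hX.integral_void_tprod (isRadialWeight_one 0) (le_refl a)
  have e : cutWeight (fun _ => 1) a = fun _ => 1 := by
    ext r
    simp [cutWeight]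
  simpa [e, outerDefect] using h

end IsNearestListed

namespace IsNearestListed

variable {Ω : Type*} [MeasurableSpace Ω] {μ : Measure Ω} [IsProbabilityMeasure μ]
  {X : ℕ → Ω → Plane} {lam : ℝ} {φ : ℝ → ℝ} {RB : ℝ}

lemma integrable_tprod (hX : IsNearestListed μ X lam) (hφ : IsRadialWeight φ RB) :
    Integrable (fun ω => ∏' i, φ ‖X i ω‖) μ :=
  Integrable.of_bound (hX.measurable_tprod hφ.measurable).aestronglyMeasurable 1
    (Eventually.of_forall fun ω => by
      have := tprod_mem_Icc fun i => hφ.mem_Icc ‖X i ω‖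
      rw [Real.norm_of_nonneg this.1]
      exact this.2)

lemma integrable_tprod_succ (hX : IsNearestListed μ X lam) (hφ : IsRadialWeight φ RB) :
    Integrable (fun ω => ∏' i, φ ‖X (i + 1) ω‖) μ :=
  Integrable.of_bound (hX.measurable_tprod_succ hφ.measurable).aestronglyMeasurable 1
    (Eventually.of_forall fun ω => by
      have := tprod_mem_Icc fun i => hφ.mem_Icc ‖X (i + 1) ω‖
      rw [Real.norm_of_nonneg this.1]
      exact this.2)

omit [IsProbabilityMeasure μ] in
lemma measurable_exp_outerDefect (hX : IsNearestListed μ X lam) (hφ : IsRadialWeight φ RB) :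
    Measurable (fun ω => Real.exp (-outerDefect lam φ (servingDist X ω))) :=
  (((hφ.outerDefect_anti lam).measurable.comp hX.measurable_servingDist).neg).exp

lemma integrable_exp_outerDefect (hX : IsNearestListed μ X lam) (hφ : IsRadialWeight φ RB) :
    Integrable (fun ω => Real.exp (-outerDefect lam φ (servingDist X ω))) μ :=
  Integrable.of_bound (hX.measurable_exp_outerDefect hφ).aestronglyMeasurable 1
    (Eventually.of_forall fun ω => by
      rw [Real.norm_of_nonneg (Real.exp_pos _).le, Real.exp_le_one_iff]
      linarith [hφ.outerDefect_nonneg lam (servingDist X ω)])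

omit [IsProbabilityMeasure μ] in
lemma measurableSet_servingDist_mem_Ioc (hX : IsNearestListed μ X lam) (a b : ℝ) :
    MeasurableSet {ω | servingDist X ω ∈ Set.Ioc a b} :=
  hX.measurable_servingDist measurableSet_Ioc

omit [IsProbabilityMeasure μ] in
lemma setIntegral_servingDist_mem_Ioc (hX : IsNearestListed μ X lam) {f : Ω → ℝ}
    (hf : Integrable f μ) {a b : ℝ} (hab : a ≤ b) :
    ∫ ω in {ω | servingDist X ω ∈ Set.Ioc a b}, f ω ∂μ =
      (∫ ω in {ω | a < servingDist X ω}, f ω ∂μ) - ∫ ω in {ω | b < servingDist X ω}, f ω ∂μ := by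
  have hs : ∀ c, MeasurableSet {ω | c < servingDist X ω} := fun c =>
    measurableSet_lt measurable_const hX.measurable_servingDist
  have e : {ω | servingDist X ω ∈ Set.Ioc a b}
      = {ω | a < servingDist X ω} \ {ω | b < servingDist X ω} := by
    ext ω
    simp [Set.mem_Ioc]
  have hsub : {ω | b < servingDist X ω} ⊆ {ω | a < servingDist X ω} :=
    fun ω hω => lt_of_le_of_lt hab hω
  rw [e, setIntegral_sdiff (hs b) hf.integrableOn hsub]

/-- With `u` and `v` the intensities of the inner disc and of the annulus, the probability is
`e^(-u) (1 - e^(-v)) ≤ v`. -/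
lemma measureReal_servingDist_mem_Ioc_le (hX : IsNearestListed μ X lam) (hlam : 0 ≤ lam)
    {a b : ℝ} (ha : 0 ≤ a) (hab : a ≤ b) :
    μ.real {ω | servingDist X ω ∈ Set.Ioc a b} ≤ (planeIntensity lam (annulus a b)).toReal := by
  have h := hX.setIntegral_servingDist_mem_Ioc (integrable_const (1 : ℝ)) hab
  simp only [setIntegral_const, smul_eq_mul, mul_one, hX.measureReal_lt_servingDist] at h
  rw [h, planeIntensity_closedBall_toReal hlam ha, planeIntensity_closedBall_toReal hlam (ha.trans hab),
    planeIntensity_annulus_toReal hlam ha hab]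
  set u := lam * Real.pi * a ^ 2
  have hu : 0 ≤ u := by positivity
  have hv : 0 ≤ lam * Real.pi * (b ^ 2 - a ^ 2) := by
    have : a ^ 2 ≤ b ^ 2 := by gcongr
    have := Real.pi_pos
    exact mul_nonneg (by positivity) (by linarith)
  have e : -(lam * Real.pi * b ^ 2) = -u + -(lam * Real.pi * (b ^ 2 - a ^ 2)) := by
    simp only [u]; ring
  rw [e, Real.exp_add]
  have h1 := Real.add_one_le_exp (-(lam * Real.pi * (b ^ 2 - a ^ 2)))
  have h2 : Real.exp (-u) ≤ 1 := Real.exp_le_one_iff.2 (by linarith)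
  have h3 := Real.exp_pos (-u)
  nlinarith

omit [IsProbabilityMeasure μ] in
/-- Unless an annulus holds two points, cutting the weight off at its outer radius does not change
the product over the points other than the nearest one. -/
lemma ae_tprod_succ_eq (hX : IsNearestListed μ X lam) (hφ : IsRadialWeight φ RB) (a b : ℝ) :
    ∀ᵐ ω ∂μ, servingDist X ω ∈ Set.Ioc a b → ¬ 2 ≤ countingMeasure X ω (annulus a b) →
      ∏' i, φ ‖X (i + 1) ω‖ = ∏' i, cutWeight φ b ‖X i ω‖ := by
  filter_upwards [hX.nearest, hX.poisson.ae_finite measurableSet_closedBall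
    (planeIntensity_closedBall_lt_top lam RB)] with ω hω hfin hω0 h2
  -- Another point within `b` would lie in the annulus together with the nearest one, as every point
  -- is at least as far as `X 0`.
  have hfar : ∀ i, b < ‖X (i + 1) ω‖ := by
    intro i
    by_contra hi
    refine h2 ?_
    rw [countingMeasure_apply X ω (measurableSet_annulus a b)]
    have hsub : (({0, i + 1} : Finset ℕ) : Set ℕ) ⊆ {i | X i ω ∈ annulus a b} := by
      intro j hj
      simp only [Finset.coe_insert, Finset.coe_singleton, Set.mem_insert_iff,
        Set.mem_singleton_iff] at hj
      rcases hj with rfl | rfl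
      · exact hω0
      · exact ⟨hω0.1.trans_le (hω _), not_lt.1 hi⟩
    have := Set.encard_le_encard hsub
    rw [Set.encard_coe_eq_coe_finsetCard, Finset.card_pair (by omega)] at this
    exact_mod_cast this
  have hm : Multipliable fun i => cutWeight φ b ‖X (i + 1) ω‖ := by
    have hpre : {i | X (i + 1) ω ∈ Metric.closedBall 0 RB}.Finite :=
      hfin.preimage (f := fun i => i + 1) (add_left_injective 1).injOn
    refine multipliable_of_hasFiniteMulSupport (hpre.subset ?_)
    intro i hi
    by_contra hi'
    simp only [Set.mem_ofPred_eq, Metric.mem_closedBall, dist_zero_right, not_le] at hi'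
    exact hi ((hφ.cut b).eq_one _ hi')
  -- The nearest point lies within `b`, so its cut-off factor is `1` and including it is harmless.
  rw [tprod_eq_zero_mul' (f := fun i => cutWeight φ b ‖X i ω‖) hm]
  have h0 : ‖X 0 ω‖ ≤ b := hω0.2
  rw [cutWeight_of_le φ h0, one_mul]
  exact tprod_congr fun i => (cutWeight_of_lt φ (hfar i)).symm

/-- The local estimate behind the conditioning: the difference is split through the cut-off product
and the constant `exp (-outerDefect lam φ b)`. The middle piece vanishes exactly and the other two
are at most `t ^ 2`. -/
lemma abs_setIntegral_Ioc_le (hX : IsNearestListed μ X lam) (hφ : IsRadialWeight φ RB)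
    (hlam : 0 ≤ lam) {a b : ℝ} (ha : 0 ≤ a) (hab : a ≤ b) :
    |∫ ω in {ω | servingDist X ω ∈ Set.Ioc a b},
      (∏' i, φ ‖X (i + 1) ω‖ - Real.exp (-outerDefect lam φ (servingDist X ω))) ∂μ|
      ≤ 2 * (planeIntensity lam (annulus a b)).toReal ^ 2 := by
  set T := {ω | servingDist X ω ∈ Set.Ioc a b} with hT
  have hTm : MeasurableSet T := hX.measurableSet_servingDist_mem_Ioc a b
  set t := (planeIntensity lam (annulus a b)).toReal
  have ht : 0 ≤ t := ENNReal.toReal_nonneg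
  have iZ := hX.integrable_tprod_succ hφ
  have iY := hX.integrable_tprod (hφ.cut b)
  have iV := hX.integrable_exp_outerDefect hφ
  have hTt : μ.real T ≤ t := hX.measureReal_servingDist_mem_Ioc_le hlam ha hab
  -- The integrand is at most `1` in absolute value and vanishes unless the annulus holds two
  -- points.
  have h1 : |∫ ω in T, (∏' i, φ ‖X (i + 1) ω‖ - ∏' i, cutWeight φ b ‖X i ω‖) ∂μ| ≤ t ^ 2 := by
    have hcm : Measurable fun ω => countingMeasure X ω (annulus a b) := by
      have e : (fun ω => countingMeasure X ω (annulus a b))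
          = fun ω => ∑' i, (annulus a b).indicator (fun _ => (1 : ℝ≥0∞)) (X i ω) := by
        ext ω
        rw [countingMeasure, Measure.sum_apply _ (measurableSet_annulus a b)]
        exact tsum_congr fun i => Measure.dirac_apply' _ (measurableSet_annulus a b)
      rw [e]
      exact Measurable.tsum fun i =>
        (measurable_const.indicator (measurableSet_annulus a b)).comp (hX.measurable_X i)
    have hSm : MeasurableSet {ω | 2 ≤ countingMeasure X ω (annulus a b)} :=
      measurableSet_le measurable_const hcm
    set S := {ω | 2 ≤ countingMeasure X ω (annulus a b)} with hS
    have hSt : μ.real S ≤ t ^ 2 := hX.poisson.measureReal_two_le (measurableSet_annulus a b)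
      (planeIntensity_annulus_lt_top lam a b)
    calc |∫ ω in T, (∏' i, φ ‖X (i + 1) ω‖ - ∏' i, cutWeight φ b ‖X i ω‖) ∂μ|
        ≤ ∫ ω in T, S.indicator (fun _ => (1 : ℝ)) ω ∂μ := by
          rw [← Real.norm_eq_abs]
          refine norm_integral_le_of_norm_le
            ((integrable_const (1 : ℝ)).indicator hSm).integrableOn ?_
          rw [ae_restrict_iff' hTm]
          filter_upwards [hX.ae_tprod_succ_eq hφ a b] with ω hω hωT
          by_cases h2 : ω ∈ S
          · rw [Set.indicator_of_mem h2, Real.norm_eq_abs, abs_le]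
            have z1 := tprod_mem_Icc fun i => hφ.mem_Icc ‖X (i + 1) ω‖
            have z2 := tprod_mem_Icc fun i => (hφ.cut b).mem_Icc ‖X i ω‖
            constructor <;> linarith [z1.1, z1.2, z2.1, z2.2]
          · rw [Set.indicator_of_notMem h2, hω hωT h2, sub_self, norm_zero]
      _ ≤ ∫ ω, S.indicator (fun _ => (1 : ℝ)) ω ∂μ :=
          setIntegral_le_integral ((integrable_const _).indicator hSm)
            (Eventually.of_forall fun ω => Set.indicator_nonneg (fun _ _ => zero_le_one) ω)
      _ = μ.real S := by
          rw [integral_indicator hSm, setIntegral_const, smul_eq_mul, mul_one]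
      _ ≤ t ^ 2 := hSt
  -- The cut-off weight depends only on points beyond `b`, so the void probabilities at `a` and at
  -- `b` both come with the same factor.
  have h2 : ∫ ω in T, ((∏' i, cutWeight φ b ‖X i ω‖) - Real.exp (-outerDefect lam φ b)) ∂μ
      = 0 := by
    rw [integral_sub iY.integrableOn (integrable_const _), setIntegral_const, smul_eq_mul, hT,
      hX.setIntegral_servingDist_mem_Ioc iY hab, hX.integral_void_tprod hφ hab,
      hX.integral_void_tprod hφ le_rfl]
    have h := hX.setIntegral_servingDist_mem_Ioc (integrable_const (1 : ℝ)) hab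
    simp only [setIntegral_const, smul_eq_mul, mul_one, hX.measureReal_lt_servingDist] at h
    rw [h]
    ring
  -- On `T` the two exponents differ by at most `t`, and `T` itself has probability at most `t`.
  have h3 : |∫ ω in T, (Real.exp (-outerDefect lam φ b)
      - Real.exp (-outerDefect lam φ (servingDist X ω))) ∂μ| ≤ t ^ 2 := by
    have h := norm_setIntegral_le_of_norm_le_const (μ := μ) (s := T) (C := t)
      (f := fun ω => Real.exp (-outerDefect lam φ b)
        - Real.exp (-outerDefect lam φ (servingDist X ω))) (measure_lt_top _ _) (fun ω hω => by
        have m1 := hφ.outerDefect_anti lam hω.2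
        have m2 := (hφ.outerDefect_anti lam hω.1.le)
        have m3 := hφ.outerDefect_sub_le lam hab
        have m4 := hφ.outerDefect_nonneg lam b
        rw [Real.norm_eq_abs, abs_of_nonneg (by
          rw [sub_nonneg, Real.exp_le_exp]
          linarith)]
        set u := outerDefect lam φ b
        set v := outerDefect lam φ (servingDist X ω)
        have e : -v = -u + -(v - u) := by ring
        rw [e, Real.exp_add]
        have n1 := Real.add_one_le_exp (-(v - u))
        have n2 : Real.exp (-u) ≤ 1 := Real.exp_le_one_iff.2 (by linarith)
        have n3 := Real.exp_pos (-u)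
        have n4 : v - u ≤ t := by linarith
        nlinarith)
    rw [Real.norm_eq_abs] at h
    nlinarith
  have e : ∫ ω in T, (∏' i, φ ‖X (i + 1) ω‖ - Real.exp (-outerDefect lam φ (servingDist X ω))) ∂μ
      = (∫ ω in T, (∏' i, φ ‖X (i + 1) ω‖ - ∏' i, cutWeight φ b ‖X i ω‖) ∂μ)
        + (∫ ω in T, ((∏' i, cutWeight φ b ‖X i ω‖) - Real.exp (-outerDefect lam φ b)) ∂μ)
        + ∫ ω in T, (Real.exp (-outerDefect lam φ b)
          - Real.exp (-outerDefect lam φ (servingDist X ω))) ∂μ := by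
    have i0 : Integrable (fun _ : Ω => Real.exp (-outerDefect lam φ b)) (μ.restrict T) :=
      integrable_const _
    rw [integral_sub iZ.integrableOn iV.integrableOn, integral_sub iZ.integrableOn iY.integrableOn,
      integral_sub iY.integrableOn i0, integral_sub i0 iV.integrableOn]
    ring
  rw [e, h2, add_zero]
  exact (abs_add_le _ _).trans (by linarith)

lemma measureReal_servingDist_nonpos (hX : IsNearestListed μ X lam) :
    μ.real {ω | servingDist X ω ≤ 0} = 0 := by
  have h := hX.measureReal_lt_servingDist 0
  have hs : MeasurableSet {ω | 0 < servingDist X ω} :=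
    measurableSet_lt measurable_const hX.measurable_servingDist
  have e : {ω | servingDist X ω ≤ 0} = {ω | 0 < servingDist X ω}ᶜ := by
    ext ω
    simp
  rw [e, probReal_compl_eq_one_sub hs, h]
  simp

lemma ae_servingDist_pos (hX : IsNearestListed μ X lam) : ∀ᵐ ω ∂μ, 0 < servingDist X ω := by
  have h := hX.measureReal_servingDist_nonpos
  rw [measureReal_eq_zero_iff] at h
  rw [ae_iff]
  simpa using h

/-- The conditional mean, given the distance of the nearest point, of the product of the weights of
the other points. -/
lemma setIntegral_tprod_succ (hX : IsNearestListed μ X lam) (hφ : IsRadialWeight φ RB)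
    (hlam : 0 ≤ lam) (r : ℝ) :
    ∫ ω in {ω | servingDist X ω ≤ r}, ∏' i, φ ‖X (i + 1) ω‖ ∂μ =
      ∫ ω in {ω | servingDist X ω ≤ r}, Real.exp (-outerDefect lam φ (servingDist X ω)) ∂μ := by
  have iZ := hX.integrable_tprod_succ hφ
  have iV := hX.integrable_exp_outerDefect hφ
  rw [← sub_eq_zero, ← integral_sub iZ.integrableOn iV.integrableOn]
  have hnull : ∀ r ≤ 0, ∫ ω in {ω | servingDist X ω ≤ r},
      (∏' i, φ ‖X (i + 1) ω‖ - Real.exp (-outerDefect lam φ (servingDist X ω))) ∂μ = 0 := by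
    intro r hr
    refine setIntegral_measure_zero _ (measure_mono_null (fun ω hω => ?_)
      ((measureReal_eq_zero_iff).1 hX.measureReal_servingDist_nonpos))
    exact le_trans hω hr
  rcases le_total r 0 with hr | hr
  · exact hnull r hr
  -- In the variable `t = r ^ 2` the intensity of an annulus is linear. For negative `t` the root is
  -- `0`, so the increment bound holds on the whole line.
  let f : ℝ → ℝ := fun t => ∫ ω in {ω | servingDist X ω ≤ √t},
      (∏' i, φ ‖X (i + 1) ω‖ - Real.exp (-outerDefect lam φ (servingDist X ω))) ∂μ
  have hf : ∀ s t, s ≤ t → |f t - f s| ≤ (2 * (lam * Real.pi) ^ 2) * (t - s) ^ 2 := by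
    intro s t hst
    have hst' := Real.sqrt_le_sqrt hst
    have hm : MeasurableSet {ω | servingDist X ω ≤ √s} :=
      measurableSet_le hX.measurable_servingDist measurable_const
    have e : f t - f s = ∫ ω in {ω | servingDist X ω ∈ Set.Ioc (√s) (√t)},
        (∏' i, φ ‖X (i + 1) ω‖ - Real.exp (-outerDefect lam φ (servingDist X ω))) ∂μ := by
      have e1 : {ω | servingDist X ω ∈ Set.Ioc (√s) (√t)}
          = {ω | servingDist X ω ≤ √t} \ {ω | servingDist X ω ≤ √s} := by
        ext ω
        simp [Set.mem_Ioc, and_comm]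
      have hsub : {ω | servingDist X ω ≤ √s} ⊆ {ω | servingDist X ω ≤ √t} :=
        fun ω hω => le_trans hω hst'
      rw [e1]
      exact (setIntegral_sdiff hm (iZ.sub iV).integrableOn hsub).symm
    rw [e]
    refine (hX.abs_setIntegral_Ioc_le hφ hlam (Real.sqrt_nonneg s) hst').trans ?_
    rw [planeIntensity_annulus_toReal hlam (Real.sqrt_nonneg s) hst', mul_pow, mul_assoc]
    have hsq : 0 ≤ √t ^ 2 - √s ^ 2 := sub_nonneg.2 (by gcongr)
    refine mul_le_mul_of_nonneg_left (mul_le_mul_of_nonneg_left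
      (pow_le_pow_left₀ hsq ?_ 2) (by positivity)) zero_le_two
    rcases le_total 0 t with ht | ht
    · have h1 : √t ^ 2 = t := Real.sq_sqrt ht
      rcases le_total 0 s with h0 | h0
      · rw [h1, Real.sq_sqrt h0]
      · rw [h1, Real.sqrt_eq_zero_of_nonpos h0]
        linarith
    · rw [Real.sqrt_eq_zero_of_nonpos ht, Real.sqrt_eq_zero_of_nonpos (hst.trans ht)]
      linarith
  have := eq_of_forall_abs_sub_le_sq hf (r ^ 2) 0
  simp only [f, Real.sqrt_sq hr, Real.sqrt_zero] at this
  rw [this]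
  exact hnull 0 le_rfl

end IsNearestListed

/-! ### Averaging over the marks -/

section Marks

variable {Ω : Type*} [MeasurableSpace Ω] {μ : Measure Ω} [IsProbabilityMeasure μ]

/-- Fubini for the product law of an independent pair, pulled back to the sample space. -/
lemma integral_comp_prodMk_of_indepFun {S T : Type*} [MeasurableSpace S] [MeasurableSpace T]
    {Y : Ω → S} {Z : Ω → T} (hY : Measurable Y) (hZ : Measurable Z) (h : IndepFun Y Z μ)
    {F : S → T → ℝ} (hF : Measurable (Function.uncurry F)) (hF1 : ∀ y z, ‖F y z‖ ≤ 1) :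
    ∫ ω, F (Y ω) (Z ω) ∂μ = ∫ ω', ∫ ω, F (Y ω') (Z ω) ∂μ ∂μ := by
  have : IsProbabilityMeasure (μ.map Y) := Measure.isProbabilityMeasure_map hY.aemeasurable
  have : IsProbabilityMeasure (μ.map Z) := Measure.isProbabilityMeasure_map hZ.aemeasurable
  have h1 : ∫ ω, F (Y ω) (Z ω) ∂μ = ∫ p, Function.uncurry F p ∂(μ.map fun ω => (Y ω, Z ω)) :=
    (integral_map (hY.prodMk hZ).aemeasurable hF.aestronglyMeasurable).symm
  have h2 : Integrable (Function.uncurry F) ((μ.map Y).prod (μ.map Z)) :=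
    Integrable.of_bound hF.aestronglyMeasurable 1 (Eventually.of_forall fun p => hF1 p.1 p.2)
  rw [h1, (indepFun_iff_map_prod_eq_prod_map_map hY.aemeasurable hZ.aemeasurable).1 h,
    integral_prod _ h2]
  have h3 := integral_map (μ := μ) hY.aemeasurable
    (hF.stronglyMeasurable.integral_prod_right (ν := μ.map Z)).aestronglyMeasurable
  refine h3.trans ?_
  refine integral_congr_ae (Eventually.of_forall fun ω' => ?_)
  exact integral_map hZ.aemeasurable (hF.of_uncurry_left).aestronglyMeasurable

/-- The mean over the marks of a mark-dependent weight. -/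
def meanWeight (β γ : Measure ℝ) (w : ℝ → ℝ → ℝ → ℝ) (r : ℝ) : ℝ := ∫ g, ∫ h, w r g h ∂γ ∂β

variable {X : ℕ → Ω → Plane} {G H : ℕ → Ω → ℝ} {lam θa θd GM Gm : ℝ} {m : ℕ}

lemma IsMmWaveTier.isProbabilityMeasure_gain (h : IsMmWaveTier μ X G H lam θa θd GM Gm m) :
    IsProbabilityMeasure (beamGainLaw θa θd GM Gm) := by
  rw [← (h.law_G 0).map_eq]
  exact Measure.isProbabilityMeasure_map (h.measurable_G 0).aemeasurable

lemma IsMmWaveTier.isProbabilityMeasure_fading (h : IsMmWaveTier μ X G H lam θa θd GM Gm m) :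
    IsProbabilityMeasure (gammaMeasure m m) := by
  rw [← (h.law_H 0).map_eq]
  exact Measure.isProbabilityMeasure_map (h.measurable_H 0).aemeasurable

/-- At fixed distances, the gains are first frozen and the fadings integrated factor by factor; then
the gains are integrated in the same way. -/
lemma IsMmWaveTier.integral_prod_marks (h : IsMmWaveTier μ X G H lam θa θd GM Gm m)
    {w : ℝ → ℝ → ℝ → ℝ} (hw : Measurable fun p : ℝ × ℝ × ℝ => w p.1 p.2.1 p.2.2)
    (hw01 : ∀ r g h, w r g h ∈ Set.Icc (0 : ℝ) 1) {N : ℕ} (r : Fin N → ℝ) :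
    ∫ ω, ∏ i, w (r i) (G i ω) (H i ω) ∂μ =
      ∏ i, meanWeight (beamGainLaw θa θd GM Gm) (gammaMeasure m m) w (r i) := by
  have := h.isProbabilityMeasure_fading
  let F : (ℕ → ℝ) → (ℕ → ℝ) → ℝ := fun g h => ∏ i, w (r i) (g i) (h i)
  have hF : Measurable (Function.uncurry F) := by
    refine Finset.measurable_fun_prod _ fun i _ => ?_
    have hi : Measurable fun q : (ℕ → ℝ) × (ℕ → ℝ) => (r i, q.1 i, q.2 i) := by fun_prop
    exact hw.comp hi
  have hF1 : ∀ g h, ‖F g h‖ ≤ 1 := fun g h => by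
    rw [Real.norm_of_nonneg (Finset.prod_nonneg fun i _ => (hw01 _ _ _).1)]
    exact Finset.prod_le_one (fun i _ => (hw01 _ _ _).1) fun i _ => (hw01 _ _ _).2
  have e1 := integral_comp_prodMk_of_indepFun (measurable_pi_lambda _ h.measurable_G)
    (measurable_pi_lambda _ h.measurable_H) h.indep_G_H hF hF1
  simp only [F] at e1
  rw [e1]
  have hwr : ∀ (r g : ℝ), Measurable (w r g) := fun r g =>
    hw.comp (measurable_const.prodMk (measurable_const.prodMk measurable_id))
  have hu : ∀ r : ℝ, Measurable fun g => ∫ h, w r g h ∂(gammaMeasure m m) := fun r => by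
    have h2 : Measurable (Function.uncurry fun g h => w r g h) :=
      hw.comp (measurable_const.prodMk measurable_id)
    exact (h2.stronglyMeasurable.integral_prod_right).measurable
  have e2 : ∀ ω', ∫ ω, ∏ i, w (r i) (G i ω') (H i ω) ∂μ
      = ∏ i, ∫ h, w (r i) (G i ω') h ∂(gammaMeasure m m) := by
    intro ω'
    have := (h.iIndep_H.precomp (Fin.val_injective (n := N))).integral_fun_prod_comp
      (f := fun i => w (r i) (G i ω')) (fun i => (h.measurable_H i).aemeasurable)
      (fun i => (hwr _ _).aestronglyMeasurable)
    refine this.trans (Finset.prod_congr rfl fun i _ => ?_)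
    exact (h.law_H i).integral_comp (hwr _ _).aestronglyMeasurable
  simp_rw [e2]
  have := (h.iIndep_G.precomp (Fin.val_injective (n := N))).integral_fun_prod_comp
      (f := fun i g => ∫ h, w (r i) g h ∂(gammaMeasure m m))
      (fun i => (h.measurable_G i).aemeasurable)
      (fun i => (hu _).aestronglyMeasurable)
  refine this.trans (Finset.prod_congr rfl fun i _ => ?_)
  exact (h.law_G i).integral_comp (hu (r i)).aestronglyMeasurable

/-- Freezing the points leaves the product of marks at fixed distances. The factor `k (X 0 ω)` will
carry the event on the nearest distance. -/
lemma IsMmWaveTier.integral_mul_prod (h : IsMmWaveTier μ X G H lam θa θd GM Gm m)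
    {w : ℝ → ℝ → ℝ → ℝ} (hw : Measurable fun p : ℝ × ℝ × ℝ => w p.1 p.2.1 p.2.2)
    (hw01 : ∀ r g h, w r g h ∈ Set.Icc (0 : ℝ) 1) {k : Plane → ℝ} (hk : Measurable k)
    (hk01 : ∀ x, k x ∈ Set.Icc (0 : ℝ) 1) (N : ℕ) :
    ∫ ω, k (X 0 ω) * ∏ i ∈ Finset.range N, w ‖X (i + 1) ω‖ (G i ω) (H i ω) ∂μ =
      ∫ ω, k (X 0 ω) * ∏ i ∈ Finset.range N,
        meanWeight (beamGainLaw θa θd GM Gm) (gammaMeasure m m) w ‖X (i + 1) ω‖ ∂μ := by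
  let F : (ℕ → Plane) → (ℕ → ℝ) × (ℕ → ℝ) → ℝ := fun x p =>
    k (x 0) * ∏ i : Fin N, w ‖x (i + 1)‖ (p.1 i) (p.2 i)
  have hF : Measurable (Function.uncurry F) := by
    refine (hk.comp ((measurable_pi_apply 0).comp measurable_fst)).mul
      (Finset.measurable_fun_prod _ fun i _ => ?_)
    have hi : Measurable fun q : (ℕ → Plane) × (ℕ → ℝ) × (ℕ → ℝ) =>
      (‖q.1 (i + 1)‖, q.2.1 i, q.2.2 i) := by fun_prop
    exact hw.comp hi
  have hF1 : ∀ x p, ‖F x p‖ ≤ 1 := fun x p => by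
    have h0 : 0 ≤ ∏ i : Fin N, w ‖x (i + 1)‖ (p.1 i) (p.2 i) :=
      Finset.prod_nonneg fun i _ => (hw01 _ _ _).1
    rw [Real.norm_of_nonneg (mul_nonneg (hk01 _).1 h0)]
    exact mul_le_one₀ (hk01 _).2 h0
      (Finset.prod_le_one (fun i _ => (hw01 _ _ _).1) fun i _ => (hw01 _ _ _).2)
  have e1 := integral_comp_prodMk_of_indepFun (measurable_pi_lambda _ h.measurable_X)
    ((measurable_pi_lambda _ h.measurable_G).prodMk (measurable_pi_lambda _ h.measurable_H))
    h.indep_X_marks hF hF1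
  simp only [F] at e1
  simp_rw [Finset.prod_range]
  rw [e1]
  refine integral_congr_ae (Eventually.of_forall fun ω' => ?_)
  simp only
  rw [integral_const_mul, h.integral_prod_marks hw hw01]

end Marks

/-! ### Testing a conditional expectation on a π-system -/

section Conditioning

variable {Ω : Type*}

/-- The intersections of a set of `𝒜` with a set `{R ≤ r}` generate `𝒜 ⊔ σ(R)`. -/
lemma generateFrom_inter_le_eq_sup (𝒜 : MeasurableSpace Ω) (R : Ω → ℝ) :
    MeasurableSpace.generateFrom
      {S | ∃ A, MeasurableSet[𝒜] A ∧ ∃ r : ℝ, S = A ∩ {ω | R ω ≤ r}} =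
      𝒜 ⊔ MeasurableSpace.comap R inferInstance := by
  apply le_antisymm
  · refine MeasurableSpace.generateFrom_le ?_
    rintro S ⟨A, hA, r, rfl⟩
    refine MeasurableSet.inter ((le_sup_left : 𝒜 ≤ _) _ hA) ?_
    exact (le_sup_right : MeasurableSpace.comap R inferInstance ≤ _) _
      ⟨Set.Iic r, measurableSet_Iic, rfl⟩
  · refine sup_le ?_ ?_
    · intro A hA
      have e : A = ⋃ n : ℕ, A ∩ {ω | R ω ≤ n} := by
        ext ω
        simp only [Set.mem_iUnion, Set.mem_inter_iff, Set.mem_ofPred_eq, exists_and_left,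
          iff_self_and]
        exact fun _ => exists_nat_ge _
      rw [e]
      exact MeasurableSet.iUnion fun n =>
        MeasurableSpace.measurableSet_generateFrom ⟨A, hA, n, rfl⟩
    · have hb : (inferInstance : MeasurableSpace ℝ)
          = MeasurableSpace.generateFrom (Set.range Set.Iic) :=
        (BorelSpace.measurable_eq (α := ℝ)).trans (borel_eq_generateFrom_Iic ℝ)
      rw [hb, MeasurableSpace.comap_generateFrom]
      refine MeasurableSpace.generateFrom_le ?_
      rintro _ ⟨_, ⟨r, rfl⟩, rfl⟩
      refine MeasurableSpace.measurableSet_generateFrom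
        ⟨Set.univ, @MeasurableSet.univ _ 𝒜, r, ?_⟩
      ext ω
      simp

/-- The sets `A ∩ {R ≤ r}` form a π-system generating the joint σ-algebra, so the π-λ theorem
applies. -/
lemma setIntegral_eq_of_forall_inter_le {𝒜 mΩ : MeasurableSpace Ω} {μ : Measure Ω}
    (h𝒜 : 𝒜 ≤ mΩ)
    {R : Ω → ℝ} (hR : Measurable R) {V W : Ω → ℝ} (hV : Integrable V μ) (hW : Integrable W μ)
    (hVW : ∀ A, MeasurableSet[𝒜] A → ∀ r : ℝ,
      ∫ ω in A ∩ {ω | R ω ≤ r}, V ω ∂μ = ∫ ω in A ∩ {ω | R ω ≤ r}, W ω ∂μ)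
    {S : Set Ω} (hS : MeasurableSet[𝒜 ⊔ MeasurableSpace.comap R inferInstance] S) :
    ∫ ω in S, V ω ∂μ = ∫ ω in S, W ω ∂μ := by
  have hle : 𝒜 ⊔ MeasurableSpace.comap R inferInstance ≤ mΩ := sup_le h𝒜 hR.comap_le
  -- Passing to complements needs equal total integrals; these come from `{R ≤ n}` as `n` grows.
  have huniv : ∫ ω, V ω ∂μ = ∫ ω, W ω ∂μ := by
    have hU : (⋃ n : ℕ, {ω | R ω ≤ n}) = Set.univ := by
      ext ω
      simpa using exists_nat_ge (R ω)
    have ht : ∀ {U : Ω → ℝ}, Integrable U μ →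
        Tendsto (fun n : ℕ => ∫ ω in {ω | R ω ≤ n}, U ω ∂μ) atTop (𝓝 (∫ ω, U ω ∂μ)) := by
      intro U hUi
      have := tendsto_setIntegral_of_monotone (μ := μ) (f := U) (s := fun n : ℕ => {ω | R ω ≤ n})
        (fun n => measurableSet_le hR measurable_const)
        (fun i j hij ω (hω : R ω ≤ i) =>
          show R ω ≤ j from le_trans hω (Nat.cast_le.2 hij)) hUi.integrableOn
      rwa [hU, setIntegral_univ] at this
    refine tendsto_nhds_unique (ht hV) ((ht hW).congr fun n => ?_)
    simpa using (hVW Set.univ (@MeasurableSet.univ _ 𝒜) n).symm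
  refine MeasurableSpace.induction_on_inter
    (C := fun S _ => ∫ ω in S, V ω ∂μ = ∫ ω in S, W ω ∂μ)
    (generateFrom_inter_le_eq_sup 𝒜 R).symm ?_ ?_ ?_ ?_ ?_ S hS
  · rintro _ ⟨A, hA, r, rfl⟩ _ ⟨B, hB, t, rfl⟩ -
    refine ⟨A ∩ B, MeasurableSet.inter hA hB, min r t, ?_⟩
    ext ω
    simp only [Set.mem_inter_iff, Set.mem_ofPred_eq, le_min_iff]
    tauto
  · simp
  · rintro _ ⟨A, hA, r, rfl⟩
    exact hVW A hA r
  · intro T hT ih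
    have h1 := integral_add_compl (hle T hT) hV
    have h2 := integral_add_compl (hle T hT) hW
    linarith
  · intro T hd hT ih
    rw [integral_iUnion (fun i => hle _ (hT i)) hd hV.integrableOn,
      integral_iUnion (fun i => hle _ (hT i)) hd hW.integrableOn]
    exact tsum_congr ih

end Conditioning

/-! ### The weight of one interferer -/

/-- The Laplace weight of an interferer at distance `r` with gain `g` and fading `h`. -/
def laplaceWeight (P C α RB s r g h : ℝ) : ℝ :=
  Real.exp (-s * (|g| * P * pathLoss RB C α |r| * |h|))

section Weight

variable {P C α RB s : ℝ}

lemma pathLoss_nonneg (hC : 0 ≤ C) {r : ℝ} (hr : 0 ≤ r) : 0 ≤ pathLoss RB C α r := by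
  unfold pathLoss
  split_ifs
  · exact mul_nonneg hC (Real.rpow_nonneg hr _)
  · exact le_rfl

lemma measurable_pathLoss : Measurable (pathLoss RB C α) :=
  Measurable.ite measurableSet_Iic (measurable_const.mul (measurable_id.pow_const _))
    measurable_const

lemma measurable_laplaceWeight :
    Measurable fun p : ℝ × ℝ × ℝ => laplaceWeight P C α RB s p.1 p.2.1 p.2.2 := by
  have h1 : Measurable fun p : ℝ × ℝ × ℝ => pathLoss RB C α |p.1| :=
    measurable_pathLoss.comp (measurable_fst.norm)
  have h2 : Measurable fun p : ℝ × ℝ × ℝ => |p.2.1| := (measurable_fst.comp measurable_snd).norm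
  have h3 : Measurable fun p : ℝ × ℝ × ℝ => |p.2.2| := (measurable_snd.comp measurable_snd).norm
  exact (measurable_const.mul (((h2.mul measurable_const).mul h1).mul h3)).exp

/-- The absolute values in the weight make this hold for all arguments; they disappear almost surely
once actual distances and marks are inserted. -/
lemma laplaceWeight_mem_Icc (hP : 0 ≤ P) (hC : 0 ≤ C) (hs : 0 ≤ s) (r g h : ℝ) :
    laplaceWeight P C α RB s r g h ∈ Set.Icc (0 : ℝ) 1 := by
  refine ⟨(Real.exp_pos _).le, Real.exp_le_one_iff.2 ?_⟩
  have := pathLoss_nonneg (RB := RB) (α := α) hC (abs_nonneg r)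
  rw [neg_mul]
  exact neg_nonpos.2 (by positivity)

lemma isRadialWeight_meanWeight {β γ : Measure ℝ} [IsProbabilityMeasure β]
    [IsProbabilityMeasure γ] (hP : 0 ≤ P) (hC : 0 ≤ C) (hs : 0 ≤ s) (hRB : 0 ≤ RB) :
    IsRadialWeight (meanWeight β γ (laplaceWeight P C α RB s)) RB where
  measurable := by
    have h1 : Measurable fun p : ℝ × ℝ => ∫ h, laplaceWeight P C α RB s p.1 p.2 h ∂γ := by
      have : Measurable fun q : (ℝ × ℝ) × ℝ => laplaceWeight P C α RB s q.1.1 q.1.2 q.2 :=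
        measurable_laplaceWeight.comp
          (f := fun q : (ℝ × ℝ) × ℝ => (q.1.1, q.1.2, q.2)) (by fun_prop)
      exact (this.stronglyMeasurable.integral_prod_right' (ν := γ)).measurable
    exact (h1.stronglyMeasurable.integral_prod_right' (ν := β)).measurable
  mem_Icc r := by
    have h : ∀ {ν : Measure ℝ} [IsProbabilityMeasure ν] {f : ℝ → ℝ},
        (∀ x, f x ∈ Set.Icc (0 : ℝ) 1) → ∫ x, f x ∂ν ∈ Set.Icc (0 : ℝ) 1 := by
      intro ν _ f hf
      refine ⟨integral_nonneg fun x => (hf x).1, ?_⟩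
      have := integral_mono_of_nonneg (μ := ν) (Eventually.of_forall fun x => (hf x).1)
        (integrable_const (1 : ℝ)) (Eventually.of_forall fun x => (hf x).2)
      simpa using this
    exact h fun g => h fun t => laplaceWeight_mem_Icc hP hC hs r g t
  eq_one r hr := by
    have : pathLoss RB C α |r| = 0 := by
      rw [abs_of_pos (hRB.trans_lt hr)]
      exact if_neg (not_le.2 hr)
    simp [meanWeight, laplaceWeight, this]

end Weight

lemma ae_nonneg_gammaMeasure (a r : ℝ) : ∀ᵐ x ∂(gammaMeasure a r), 0 ≤ x := by
  have e : {x : ℝ | ¬ 0 ≤ x} = Set.Iio 0 := by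
    ext x
    simp
  rw [ae_iff, e, gammaMeasure, withDensity_apply _ measurableSet_Iio]
  exact lintegral_gammaPDF_of_nonpos le_rfl

/-! ### The conditional Laplace transform as an integral over the plane -/

namespace IsMmWaveTier

variable {Ω : Type*} [mΩ : MeasurableSpace Ω] {μ : Measure Ω} [IsProbabilityMeasure μ]
  {X : ℕ → Ω → Plane} {G H : ℕ → Ω → ℝ} {lam θa θd GM Gm P C α RB s : ℝ} {m : ℕ}

omit [IsProbabilityMeasure μ] in
lemma isNearestListed (h : IsMmWaveTier μ X G H lam θa θd GM Gm m) : IsNearestListed μ X lam :=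
  ⟨h.measurable_X, h.poisson, h.nearest⟩

omit [IsProbabilityMeasure μ] in
lemma ae_gain_nonneg (h : IsMmWaveTier μ X G H lam θa θd GM Gm m) (hGM : 0 ≤ GM) (hGm : 0 ≤ Gm) :
    ∀ᵐ ω ∂μ, ∀ i, 0 ≤ G i ω := by
  rw [ae_all_iff]
  intro i
  have h1 : ∀ᵐ x ∂(beamGainLaw θa θd GM Gm), 0 ≤ x := by
    have hs : MeasurableSet {x : ℝ | ¬ 0 ≤ x} := (measurableSet_Ici (a := (0 : ℝ))).compl
    rw [ae_iff, beamGainLaw, Measure.add_apply, Measure.smul_apply, Measure.smul_apply,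
      Measure.dirac_apply' _ hs, Measure.dirac_apply' _ hs]
    simp [hGM, hGm]
  rw [← (h.law_G i).map_eq] at h1
  exact ae_of_ae_map (h.law_G i).aemeasurable h1

omit [IsProbabilityMeasure μ] in
lemma ae_fading_nonneg (h : IsMmWaveTier μ X G H lam θa θd GM Gm m) :
    ∀ᵐ ω ∂μ, ∀ i, 0 ≤ H i ω := by
  rw [ae_all_iff]
  intro i
  have h1 := ae_nonneg_gammaMeasure m m
  rw [← (h.law_H i).map_eq] at h1
  exact ae_of_ae_map (h.law_H i).aemeasurable h1

omit [IsProbabilityMeasure μ] in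
lemma measurable_interference (h : IsMmWaveTier μ X G H lam θa θd GM Gm m) :
    Measurable (interference X G H P C α RB) :=
  Measurable.tsum fun i => (((h.measurable_G i).mul measurable_const).mul
    (measurable_pathLoss.comp (h.measurable_X (i + 1)).norm)).mul (h.measurable_H i)

omit [IsProbabilityMeasure μ] in
lemma ae_finite_succ (h : IsMmWaveTier μ X G H lam θa θd GM Gm m) (RB : ℝ) :
    ∀ᵐ ω ∂μ, {i | ‖X (i + 1) ω‖ ≤ RB}.Finite := by
  filter_upwards [h.isNearestListed.poisson.ae_finite measurableSet_closedBall
    (planeIntensity_closedBall_lt_top lam RB)] with ω hω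
  have := hω.preimage (f := fun i => i + 1) (add_left_injective 1).injOn
  refine this.subset fun i hi => ?_
  have hi' : ‖X (i + 1) ω‖ ≤ RB := hi
  simpa using hi'

omit [IsProbabilityMeasure μ] in
-- Almost surely the marks are nonnegative and only finitely many interferers are in range, so the
-- partial products are exponentials of partial sums of a convergent series.
lemma ae_tendsto_prod_laplaceWeight (h : IsMmWaveTier μ X G H lam θa θd GM Gm m)
    (hGM : 0 ≤ GM) (hGm : 0 ≤ Gm) : ∀ᵐ ω ∂μ,
      Tendsto (fun N => ∏ i ∈ Finset.range N,
        laplaceWeight P C α RB s ‖X (i + 1) ω‖ (G i ω) (H i ω)) atTop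
        (𝓝 (Real.exp (-s * interference X G H P C α RB ω))) := by
  filter_upwards [h.ae_gain_nonneg hGM hGm, h.ae_fading_nonneg, h.ae_finite_succ RB]
    with ω hG hH hfin
  have hsum : Summable fun i => G i ω * P * pathLoss RB C α ‖X (i + 1) ω‖ * H i ω := by
    refine summable_of_hasFiniteSupport (hfin.subset fun i hi => ?_)
    by_contra hi'
    have hi2 : ¬ ‖X (i + 1) ω‖ ≤ RB := hi'
    exact hi (by simp [pathLoss, hi2])
  have h1 := ((hsum.hasSum.tendsto_sum_nat).const_mul (-s)).rexp
  refine h1.congr fun N => ?_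
  rw [Finset.mul_sum, Real.exp_sum]
  refine Finset.prod_congr rfl fun i _ => ?_
  rw [laplaceWeight, abs_of_nonneg (hG i), abs_of_nonneg (hH i), abs_norm]

end IsMmWaveTier

namespace IsMmWaveTier

variable {Ω : Type*} {lam θa θd GM Gm P C α RB s : ℝ} {m : ℕ}

/-- The weight of an interferer, averaged over its marks. -/
abbrev tierWeight (θa θd GM Gm P C α RB s : ℝ) (m : ℕ) : ℝ → ℝ :=
  meanWeight (beamGainLaw θa θd GM Gm) (gammaMeasure m m) (laplaceWeight P C α RB s)

lemma isRadialWeight_tierWeight [MeasurableSpace Ω] {μ : Measure Ω} [IsProbabilityMeasure μ]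
    {X : ℕ → Ω → Plane} {G H : ℕ → Ω → ℝ}
    (h : IsMmWaveTier μ X G H lam θa θd GM Gm m) (hP : 0 ≤ P) (hC : 0 ≤ C)
    (hs : 0 ≤ s) (hRB : 0 ≤ RB) : IsRadialWeight (tierWeight θa θd GM Gm P C α RB s m) RB :=
  have := h.isProbabilityMeasure_gain
  have := h.isProbabilityMeasure_fading
  isRadialWeight_meanWeight hP hC hs hRB

/-- The Laplace transform of the interference on the event that the nearest base station is within
the distance `r`. -/
lemma setIntegral_exp_interference [MeasurableSpace Ω] {μ : Measure Ω} [IsProbabilityMeasure μ]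
    {X : ℕ → Ω → Plane} {G H : ℕ → Ω → ℝ}
    (h : IsMmWaveTier μ X G H lam θa θd GM Gm m) (hlam : 0 ≤ lam) (hGM : 0 ≤ GM) (hGm : 0 ≤ Gm)
    (hP : 0 ≤ P) (hC : 0 ≤ C) (hs : 0 ≤ s) (hRB : 0 ≤ RB) (r : ℝ) :
    ∫ ω in {ω | servingDist X ω ≤ r}, Real.exp (-s * interference X G H P C α RB ω) ∂μ =
      ∫ ω in {ω | servingDist X ω ≤ r}, Real.exp
        (-outerDefect lam (tierWeight θa θd GM Gm P C α RB s m) (servingDist X ω)) ∂μ := by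
  have hφ := h.isRadialWeight_tierWeight (α := α) hP hC hs hRB
  rw [← h.isNearestListed.setIntegral_tprod_succ hφ hlam]
  set φ := tierWeight θa θd GM Gm P C α RB s m with hφdef
  have hm : MeasurableSet {ω | servingDist X ω ≤ r} :=
    measurableSet_le h.isNearestListed.measurable_servingDist measurable_const
  have hprod : ∀ (u : ℕ → ℝ), (∀ i, u i ∈ Set.Icc (0 : ℝ) 1) → ∀ N,
      ‖∏ i ∈ Finset.range N, u i‖ ≤ 1 := fun u hu N => by
    rw [Real.norm_of_nonneg (Finset.prod_nonneg fun i _ => (hu i).1)]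
    exact Finset.prod_le_one (fun i _ => (hu i).1) fun i _ => (hu i).2
  -- The marks can be averaged only in finite products, so both sides are truncated to the first `N`
  -- interferers and recovered by dominated convergence.
  have t1 : Tendsto (fun N => ∫ ω in {ω | servingDist X ω ≤ r}, ∏ i ∈ Finset.range N,
      laplaceWeight P C α RB s ‖X (i + 1) ω‖ (G i ω) (H i ω) ∂μ) atTop
      (𝓝 (∫ ω in {ω | servingDist X ω ≤ r},
        Real.exp (-s * interference X G H P C α RB ω) ∂μ)) := by
    refine tendsto_integral_of_dominated_convergence (fun _ => 1) (fun N => ?_)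
      (integrable_const _) (fun N => Eventually.of_forall fun ω => ?_)
      (ae_restrict_of_ae (h.ae_tendsto_prod_laplaceWeight hGM hGm))
    · exact (Finset.measurable_fun_prod _ fun i _ => measurable_laplaceWeight.comp
        ((h.measurable_X (i + 1)).norm.prodMk
          ((h.measurable_G i).prodMk (h.measurable_H i)))).aestronglyMeasurable
    · exact hprod _ (fun i => laplaceWeight_mem_Icc hP hC hs _ _ _) N
  have t2 : Tendsto (fun N => ∫ ω in {ω | servingDist X ω ≤ r}, ∏ i ∈ Finset.range N,
      φ ‖X (i + 1) ω‖ ∂μ) atTop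
      (𝓝 (∫ ω in {ω | servingDist X ω ≤ r}, ∏' i, φ ‖X (i + 1) ω‖ ∂μ)) := by
    refine tendsto_integral_of_dominated_convergence (fun _ => 1) (fun N => ?_)
      (integrable_const _) (fun N => Eventually.of_forall fun ω => ?_)
      (ae_restrict_of_ae ?_)
    · exact (Finset.measurable_fun_prod _ fun i _ =>
        hφ.measurable.comp (h.measurable_X (i + 1)).norm).aestronglyMeasurable
    · exact hprod _ (fun i => hφ.mem_Icc _) N
    · filter_upwards [h.ae_finite_succ RB] with ω hω
      have : Multipliable fun i => φ ‖X (i + 1) ω‖ := by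
        refine multipliable_of_hasFiniteMulSupport (hω.subset fun i hi => ?_)
        by_contra hi'
        have hi2 : ¬ ‖X (i + 1) ω‖ ≤ RB := hi'
        exact hi (hφ.eq_one _ (not_le.1 hi2))
      exact this.hasProd.tendsto_prod_nat
  refine tendsto_nhds_unique t1 (t2.congr fun N => ?_)
  -- The event `R ≤ r` is written as a function of `X 0`, which the averaging over marks leaves
  -- untouched.
  let k : Plane → ℝ := (Metric.closedBall (0 : Plane) r).indicator fun _ => 1
  have hk : Measurable k := measurable_const.indicator measurableSet_closedBall
  have hk01 : ∀ x, k x ∈ Set.Icc (0 : ℝ) 1 := fun x => by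
    by_cases hx : x ∈ Metric.closedBall (0 : Plane) r <;>
      simp only [k, hx, Set.indicator_of_mem, Set.indicator_of_notMem, not_false_eq_true] <;> simp
  have key := h.integral_mul_prod (measurable_laplaceWeight (P := P) (C := C) (α := α) (RB := RB)
    (s := s)) (laplaceWeight_mem_Icc hP hC hs) hk hk01 N
  have hind : ∀ f : Ω → ℝ, ∫ ω, k (X 0 ω) * f ω ∂μ = ∫ ω in {ω | servingDist X ω ≤ r}, f ω ∂μ := by
    intro f
    rw [← integral_indicator hm]
    refine integral_congr_ae (Eventually.of_forall fun ω => ?_)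
    by_cases hω : ‖X 0 ω‖ ≤ r
    · have h1 : X 0 ω ∈ Metric.closedBall (0 : Plane) r := by simpa using hω
      have h2 : ω ∈ {ω | servingDist X ω ≤ r} := hω
      simp only [k, h1, h2, Set.indicator_of_mem, one_mul]
    · have h1 : X 0 ω ∉ Metric.closedBall (0 : Plane) r := by simpa using hω
      have h2 : ω ∉ {ω | servingDist X ω ≤ r} := hω
      simp only [k, h1, h2, Set.indicator_of_notMem, zero_mul, not_false_eq_true]
  rw [hind, hind] at key
  exact key.symm

/-- The restriction to `{R ≤ r}` is absorbed into the function of the tier, which is independent of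
`A`. -/
lemma setIntegral_inter_eq_mul {𝒜 mΩ : MeasurableSpace Ω} {μ : Measure Ω} [IsProbabilityMeasure μ]
    {X : ℕ → Ω → Plane} {G H : ℕ → Ω → ℝ}
    (h : IsMmWaveTier μ X G H lam θa θd GM Gm m)
    (h𝒜 : 𝒜 ≤ mΩ) (hindep : Indep 𝒜 (tierSigma X G H) μ) {A : Set Ω} (hA : MeasurableSet[𝒜] A)
    (r : ℝ) {F : (ℕ → Plane) × (ℕ → ℝ) × (ℕ → ℝ) → ℝ} (hF : Measurable F) :
    ∫ ω in A ∩ {ω | servingDist X ω ≤ r}, F (fun i => X i ω, fun i => G i ω, fun i => H i ω) ∂μ =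
      μ.real A * ∫ ω in {ω | servingDist X ω ≤ r},
        F (fun i => X i ω, fun i => G i ω, fun i => H i ω) ∂μ := by
  have hm : MeasurableSet {ω | servingDist X ω ≤ r} :=
    measurableSet_le h.isNearestListed.measurable_servingDist measurable_const
  have hD : MeasurableSet {p : (ℕ → Plane) × (ℕ → ℝ) × (ℕ → ℝ) | ‖p.1 0‖ ≤ r} :=
    measurableSet_le (by fun_prop) measurable_const
  have hT : Measurable fun ω => ((fun i => X i ω, fun i => G i ω, fun i => H i ω) :
      (ℕ → Plane) × (ℕ → ℝ) × (ℕ → ℝ)) :=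
    (measurable_pi_lambda _ h.measurable_X).prodMk
      ((measurable_pi_lambda _ h.measurable_G).prodMk (measurable_pi_lambda _ h.measurable_H))
  have key := Indep.setIntegral_eq_smul h𝒜 hindep hT.aemeasurable hA
    (hF.indicator hD).aestronglyMeasurable
  rw [smul_eq_mul] at key
  rw [← setIntegral_indicator hm]
  rw [← integral_indicator hm]
  exact key

/-- The conditional Laplace transform of the interference, as the exponential of an integral over
the plane. -/
lemma condLaplace_ae_eq {𝒜 mΩ : MeasurableSpace Ω} {μ : Measure Ω} [IsProbabilityMeasure μ]
    {X : ℕ → Ω → Plane} {G H : ℕ → Ω → ℝ}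
    (h : IsMmWaveTier μ X G H lam θa θd GM Gm m) (hlam : 0 ≤ lam) (hGM : 0 ≤ GM) (hGm : 0 ≤ Gm)
    (hP : 0 ≤ P) (hC : 0 ≤ C) (hs : 0 ≤ s) (hRB : 0 ≤ RB)
    (h𝒜 : 𝒜 ≤ mΩ) (hindep : Indep 𝒜 (tierSigma X G H) μ) :
    ∀ᵐ ω ∂μ, condLaplace μ 𝒜 X G H P C α RB s ω = Real.exp
        (-outerDefect lam (tierWeight θa θd GM Gm P C α RB s m) (servingDist X ω)) := by
  have hφ := h.isRadialWeight_tierWeight (α := α) hP hC hs hRB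
  have hN := h.isNearestListed
  set φ := tierWeight θa θd GM Gm P C α RB s m with hφdef
  have hle : 𝒜 ⊔ MeasurableSpace.comap (servingDist X) inferInstance ≤ mΩ :=
    sup_le h𝒜 hN.measurable_servingDist.comap_le
  have hV := hN.integrable_exp_outerDefect hφ
  have hW : Integrable (fun ω => Real.exp (-s * interference X G H P C α RB ω)) μ := by
    refine Integrable.of_bound
      (measurable_const.mul h.measurable_interference).exp.aestronglyMeasurable 1 ?_
    filter_upwards [h.ae_gain_nonneg hGM hGm, h.ae_fading_nonneg] with ω hG hH
    rw [Real.norm_of_nonneg (Real.exp_pos _).le, Real.exp_le_one_iff, neg_mul]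
    refine neg_nonpos.2 (mul_nonneg hs (tsum_nonneg fun i => ?_))
    have := pathLoss_nonneg (RB := RB) (α := α) hC (norm_nonneg (X (i + 1) ω))
    have h1 := hG i
    have h2 := hH i
    positivity
  refine Filter.EventuallyEq.symm (ae_eq_condExp_of_forall_setIntegral_eq hle hW
    (fun S _ _ => hV.integrableOn) (fun S hS _ => ?_) ?_)
  · refine setIntegral_eq_of_forall_inter_le h𝒜 hN.measurable_servingDist hV hW
      (fun A hA r => ?_) hS
    have m1 : Measurable fun p : (ℕ → Plane) × (ℕ → ℝ) × (ℕ → ℝ) =>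
        Real.exp (-outerDefect lam φ ‖p.1 0‖) :=
      ((hφ.outerDefect_anti lam).measurable.comp (by fun_prop : Measurable
        fun p : (ℕ → Plane) × (ℕ → ℝ) × (ℕ → ℝ) => ‖p.1 0‖)).neg.exp
    have m2 : Measurable fun p : (ℕ → Plane) × (ℕ → ℝ) × (ℕ → ℝ) =>
        Real.exp (-s * ∑' i, p.2.1 i * P * pathLoss RB C α ‖p.1 (i + 1)‖ * p.2.2 i) := by
      refine (measurable_const.mul (Measurable.tsum fun i => ?_)).exp
      have a1 : Measurable fun p : (ℕ → Plane) × (ℕ → ℝ) × (ℕ → ℝ) => ‖p.1 (i + 1)‖ := by fun_prop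
      have a2 : Measurable fun p : (ℕ → Plane) × (ℕ → ℝ) × (ℕ → ℝ) => p.2.1 i := by fun_prop
      have a3 : Measurable fun p : (ℕ → Plane) × (ℕ → ℝ) × (ℕ → ℝ) => p.2.2 i := by fun_prop
      exact ((a2.mul measurable_const).mul (measurable_pathLoss.comp a1)).mul a3
    have k1 := h.setIntegral_inter_eq_mul h𝒜 hindep hA r m1
    have k2 := h.setIntegral_inter_eq_mul h𝒜 hindep hA r m2
    have k3 := h.setIntegral_exp_interference (α := α) hlam hGM hGm hP hC hs hRB r
    -- Both sides carry the factor `μ.real A`; what remains concerns the tier alone.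
    exact k1.trans ((congrArg (μ.real A * ·) k3.symm).trans k2.symm)
  · refine Measurable.aestronglyMeasurable ?_
    have hR : Measurable[𝒜 ⊔ MeasurableSpace.comap (servingDist X) inferInstance]
        (servingDist X) :=
      (comap_measurable (servingDist X)).mono le_sup_right le_rfl
    exact (((hφ.outerDefect_anti lam).measurable.comp hR).neg).exp

end IsMmWaveTier

/-! ### Evaluating the exponent: Gamma law, polar coordinates, change of variables -/

/-- The Laplace transform of the Gamma law. -/
lemma integral_exp_neg_mul_gammaMeasure {a r c : ℝ} (ha : 0 < a) (hr : 0 < r) (hc : 0 ≤ c) :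
    ∫ x, Real.exp (-(c * x)) ∂(gammaMeasure a r) = (r / (r + c)) ^ a := by
  rw [gammaMeasure, integral_withDensity_eq_integral_toReal_smul
    (f := gammaPDF a r) (measurable_gammaPDFReal a r).ennreal_ofReal
    (Eventually.of_forall fun x => ENNReal.ofReal_lt_top)]
  have e : ∀ x, (gammaPDF a r x).toReal • Real.exp (-(c * x)) =
      (Set.Ici (0 : ℝ)).indicator
        (fun x => r ^ a / Real.Gamma a * (x ^ (a - 1) * Real.exp (-((r + c) * x)))) x := by
    intro x
    rw [gammaPDF, ENNReal.toReal_ofReal (gammaPDFReal_nonneg ha hr x), smul_eq_mul, gammaPDFReal]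
    by_cases hx : 0 ≤ x
    · rw [if_pos hx, Set.indicator_of_mem (by exact hx)]
      rw [mul_assoc, mul_assoc, ← Real.exp_add]
      congr 3
      ring_nf
    · rw [if_neg hx, Set.indicator_of_notMem (by exact hx), zero_mul]
  simp_rw [e]
  rw [integral_indicator measurableSet_Ici, integral_Ici_eq_integral_Ioi, integral_const_mul,
    Real.integral_rpow_mul_exp_neg_mul_Ioi ha (by linarith), Real.div_rpow hr.le (by linarith),
    Real.div_rpow zero_le_one (by linarith), Real.one_rpow]
  have := (Real.Gamma_pos_of_pos ha).ne'
  field_simp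

lemma mainLobeProb_mem_Icc {θa θd : ℝ} (hθa : 0 ≤ θa) (hθa' : θa ≤ 2 * Real.pi) (hθd : 0 ≤ θd)
    (hθd' : θd ≤ Real.pi) : mainLobeProb θa θd ∈ Set.Icc (0 : ℝ) 1 := by
  have hpi := Real.pi_pos
  have h1 : θa / (2 * Real.pi) ≤ 1 := div_le_one_of_le₀ hθa' (by positivity)
  have h2 : θd / Real.pi ≤ 1 := div_le_one_of_le₀ hθd' hpi.le
  unfold mainLobeProb
  exact ⟨by positivity, mul_le_one₀ h1 (by positivity) h2⟩

lemma integral_beamGainLaw {θa θd : ℝ} (hp : mainLobeProb θa θd ∈ Set.Icc (0 : ℝ) 1) (GM Gm : ℝ)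
    (f : ℝ → ℝ) :
    ∫ g, f g ∂(beamGainLaw θa θd GM Gm) =
      ∑ j : Bool, lobeProb θa θd j * f (if j then GM else Gm) := by
  rw [beamGainLaw, integral_add_measure
    ((integrable_dirac (by simp)).smul_measure ENNReal.ofReal_ne_top)
    ((integrable_dirac (by simp)).smul_measure ENNReal.ofReal_ne_top), integral_smul_measure,
    integral_smul_measure, integral_dirac, integral_dirac, ENNReal.toReal_ofReal hp.1,
    ENNReal.toReal_ofReal (sub_nonneg.2 hp.2)]
  simp [lobeProb]

lemma sum_lobeProb (θa θd : ℝ) : ∑ j : Bool, lobeProb θa θd j = 1 := by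
  simp [lobeProb]

lemma lobeConst_nonneg {s P C GM Gm : ℝ} (hs : 0 ≤ s) (hP : 0 ≤ P) (hC : 0 ≤ C) (hGM : 0 ≤ GM)
    (hGm : 0 ≤ Gm) (m : ℕ) (j : Bool) : 0 ≤ lobeConst s P C GM Gm m j := by
  unfold lobeConst
  split_ifs <;> positivity

/-- The mean weight of an interferer in line of sight. -/
lemma tierWeight_eq {θa θd GM Gm P C α RB s : ℝ} {m : ℕ}
    (hp : mainLobeProb θa θd ∈ Set.Icc (0 : ℝ) 1) (hGM : 0 ≤ GM)
    (hGm : 0 ≤ Gm) (hP : 0 ≤ P) (hC : 0 ≤ C) (hs : 0 ≤ s) (hm : 1 ≤ m) {r : ℝ} (hr : 0 < r)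
    (hrB : r ≤ RB) :
    IsMmWaveTier.tierWeight θa θd GM Gm P C α RB s m r = ∑ j : Bool, lobeProb θa θd j *
      ((1 + lobeConst s P C GM Gm m j * r ^ (-α)) ^ m)⁻¹ := by
  have hm' : (0 : ℝ) < m := by exact_mod_cast hm
  rw [IsMmWaveTier.tierWeight, meanWeight, integral_beamGainLaw hp]
  refine Finset.sum_congr rfl fun j _ => ?_
  congr 1
  set g : ℝ := if j then GM else Gm with hg
  have hg0 : 0 ≤ g := by
    rw [hg]
    split_ifs <;> assumption
  have hc : 0 ≤ s * (g * P * (C * r ^ (-α))) := by positivity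
  have e : ∀ᵐ h ∂(gammaMeasure m m), laplaceWeight P C α RB s r g h
      = Real.exp (-((s * (g * P * (C * r ^ (-α)))) * h)) := by
    filter_upwards [ae_nonneg_gammaMeasure m m] with x hx
    rw [laplaceWeight, abs_of_nonneg hg0, abs_of_pos hr, abs_of_nonneg hx, pathLoss, if_pos hrB]
    ring_nf
  rw [integral_congr_ae e, integral_exp_neg_mul_gammaMeasure hm' hm' hc, Real.rpow_natCast,
    ← inv_pow]
  congr 1
  rw [lobeConst, ← hg]
  field_simp

/-- The defect integral in polar coordinates. -/
lemma outerDefect_eq_intervalIntegral {lam : ℝ} (hlam : 0 ≤ lam) {φ : ℝ → ℝ} {RB R : ℝ}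
    (hφ : IsRadialWeight φ RB) (hR : 0 < R) (hRB : R ≤ RB) :
    outerDefect lam φ R = 2 * Real.pi * lam * ∫ r in R..RB, r * (1 - φ r) := by
  have h1 := integral_fun_norm_addHaar (volume : Measure Plane)
    ((Set.Ioc R RB).indicator fun r => 1 - φ r)
  have h2 : outerDefect lam φ R
      = lam * ∫ x : Plane, (Set.Ioc R RB).indicator (fun r => 1 - φ r) ‖x‖ := by
    rw [outerDefect, planeIntensity, Measure.restrict_smul, integral_smul_measure,
      ENNReal.toReal_ofReal hlam, smul_eq_mul, ← integral_indicator (measurableSet_lt_norm R)]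
    congr 2
    ext x
    by_cases hx : R < ‖x‖
    · rw [Set.indicator_of_mem (by exact hx)]
      by_cases hx2 : ‖x‖ ≤ RB
      · rw [Set.indicator_of_mem (show ‖x‖ ∈ Set.Ioc R RB from ⟨hx, hx2⟩)]
      · rw [Set.indicator_of_notMem fun h => hx2 h.2, hφ.eq_one _ (not_le.1 hx2), sub_self]
    · rw [Set.indicator_of_notMem (by exact hx), Set.indicator_of_notMem fun h => hx h.1]
  have hfin : Module.finrank ℝ Plane = 2 := by simp
  have hvol : (volume : Measure Plane).real (Metric.ball 0 1) = Real.pi := by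
    rw [measureReal_def, EuclideanSpace.volume_ball_fin_two, ENNReal.toReal_mul,
      ENNReal.toReal_pow, ENNReal.toReal_ofReal zero_le_one]
    simp [Real.pi_pos.le]
  rw [h2, h1, hfin, hvol]
  have h3 : ∫ y in Set.Ioi (0 : ℝ), y ^ (2 - 1) • (Set.Ioc R RB).indicator (fun r => 1 - φ r) y
      = ∫ r in R..RB, r * (1 - φ r) := by
    rw [intervalIntegral.integral_of_le hRB, ← integral_indicator measurableSet_Ioi,
      ← integral_indicator measurableSet_Ioc]
    congr 1
    ext y
    by_cases hy : y ∈ Set.Ioc R RB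
    · have : y ∈ Set.Ioi (0 : ℝ) := hR.trans hy.1
      simp [Set.indicator_of_mem, hy, this]
    · simp [Set.indicator_of_notMem hy]
  rw [h3]
  simp
  ring

/-- The binomial theorem for `(1 + v) ^ m - 1`; dropping the constant term is why the sum starts at
`i = 1`. -/
lemma one_sub_inv_pow_eq_sum {v : ℝ} (hv : 0 ≤ v) (m : ℕ) :
    1 - ((1 + v) ^ m)⁻¹ = ∑ i ∈ Finset.Icc 1 m, (m.choose i : ℝ) * (v ^ i * ((1 + v) ^ m)⁻¹) := by
  have h1 : (1 + v) ^ m = 1 + ∑ i ∈ Finset.Icc 1 m, (m.choose i : ℝ) * v ^ i := by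
    rw [add_comm 1 v, add_pow, Finset.range_eq_Ico, Finset.sum_eq_sum_Ico_succ_bot (by omega)]
    simp only [pow_zero, one_pow, mul_one, Nat.choose_zero_right, Nat.cast_one, zero_add]
    congr 1
    refine Finset.sum_congr ?_ fun i _ => mul_comm _ _
    ext i
    simp only [Finset.mem_Ico, Finset.mem_Icc]
    omega
  have h2 : (1 + v) ^ m ≠ 0 := by positivity
  simp_rw [← mul_assoc]
  rw [← Finset.sum_mul, eq_sub_of_add_eq' h1.symm]
  field_simp

/-- For `t < 0` the principal power is `(-t) ^ a * exp (iπa)`, and `(-1) ^ (-a)` is the inverse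
phase. -/
lemma neg_one_cpow_mul_cpow {t : ℝ} (ht : t < 0) (a : ℝ) :
    (-1 : ℂ) ^ ((-a : ℝ) : ℂ) * (t : ℂ) ^ (a : ℂ) = (((-t) ^ a : ℝ) : ℂ) := by
  have h1 := Complex.ofReal_cpow_of_nonpos (x := -1) (by norm_num) ((-a : ℝ) : ℂ)
  have h2 := Complex.ofReal_cpow_of_nonpos ht.le (a : ℂ)
  simp only [Complex.ofReal_neg, Complex.ofReal_one, neg_neg, Complex.one_cpow, one_mul] at h1
  rw [Complex.ofReal_neg, h1, h2, mul_left_comm, ← Complex.exp_add,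
    Complex.ofReal_cpow (by linarith), Complex.ofReal_neg]
  have : (Real.pi : ℂ) * Complex.I * -(a : ℂ) + Real.pi * Complex.I * a = 0 := by ring
  rw [this, Complex.exp_zero, mul_one]

/-- The generalized incomplete Beta function on the negative half line as a real integral. -/
lemma neg_one_cpow_mul_genIncBeta {x y : ℝ} (hx : x < 0) (hy : y < 0) (a : ℝ) (m : ℕ) :
    (-1 : ℂ) ^ ((1 - a : ℝ) : ℂ) * genIncBeta x y (a : ℂ) (1 - (m : ℂ)) =
      ((∫ t in x..y, (-t) ^ (a - 1) * ((1 - t) ^ m)⁻¹ : ℝ) : ℂ) := by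
  rw [genIncBeta, ← intervalIntegral.integral_const_mul, ← intervalIntegral.integral_ofReal]
  refine intervalIntegral.integral_congr fun t ht => ?_
  have ht0 : t < 0 := ht.2.trans_lt (max_lt hx hy)
  have h1 := neg_one_cpow_mul_cpow ht0 (a - 1)
  rw [neg_sub] at h1
  have e : (1 - (m : ℂ)) - 1 = -(m : ℂ) := by ring
  rw [e, ← mul_assoc, Complex.ofReal_mul, ← h1, Complex.cpow_neg, Complex.cpow_natCast]
  push_cast
  rfl

/-- The change of variables `t = -c r^(-α)`. -/
lemma integral_pathLoss_pow {c α R RB : ℝ} (hc : 0 < c) (hα : 0 < α) (hR : 0 < R)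
    (hRB : R ≤ RB) (i m : ℕ) :
    ∫ r in R..RB, r * ((c * r ^ (-α)) ^ i * ((1 + c * r ^ (-α)) ^ m)⁻¹) =
      c ^ (2 / α) / α * ∫ t in (-(c / R ^ α))..(-(c / RB ^ α)),
        (-t) ^ ((i - 2 / α : ℝ) - 1) * ((1 - t) ^ m)⁻¹ := by
  have hpos : ∀ r ∈ Set.uIcc R RB, 0 < r := fun r hr => by
    rw [Set.uIcc_of_le hRB] at hr
    exact hR.trans_le hr.1
  have hd : ∀ r ∈ Set.uIcc R RB,
      HasDerivAt (fun r => -(c * r ^ (-α))) (c * α * r ^ (-α - 1)) r := fun r hr => by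
    convert! ((Real.hasDerivAt_rpow_const (p := -α) (Or.inl (hpos r hr).ne')).const_mul c).neg
      using 1
    ring
  have hcont : ContinuousOn (fun r : ℝ => c * α * r ^ (-α - 1)) (Set.uIcc R RB) :=
    continuousOn_const.mul (continuousOn_id.rpow_const fun r hr => Or.inl (hpos r hr).ne')
  have hneg : ∀ t ∈ (fun r => -(c * r ^ (-α))) '' Set.uIcc R RB, t < 0 := by
    rintro _ ⟨r, hr, rfl⟩
    have := Real.rpow_pos_of_pos (hpos r hr) (-α)
    exact neg_neg_of_pos (by positivity)
  have hg : ContinuousOn (fun t : ℝ => (-t) ^ ((i - 2 / α : ℝ) - 1) * ((1 - t) ^ m)⁻¹)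
      ((fun r => -(c * r ^ (-α))) '' Set.uIcc R RB) := by
    refine ContinuousOn.mul (continuousOn_id.neg.rpow_const fun t ht => Or.inl ?_)
      (((continuousOn_const.sub continuousOn_id).pow m).inv₀ fun t ht => ?_)
    · have := hneg t ht
      exact (neg_pos.2 this).ne'
    · have := hneg t ht
      have h1 : (0 : ℝ) < 1 - t := by linarith
      exact (pow_pos h1 m).ne'
  have key := intervalIntegral.integral_comp_mul_deriv' hd hcont hg
  have e : ∀ r : ℝ, c / r ^ α = c * r ^ (-α) ∨ r < 0 := by
    intro r
    rcases le_or_gt 0 r with h | h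
    · left
      rw [Real.rpow_neg h, div_eq_mul_inv]
    · exact Or.inr h
  rw [(e R).resolve_right (not_lt.2 hR.le), (e RB).resolve_right (not_lt.2 (hR.le.trans hRB)),
    ← key, ← intervalIntegral.integral_const_mul]
  refine intervalIntegral.integral_congr fun r hr => ?_
  have hr0 := hpos r hr
  have hv : 0 < c * r ^ (-α) := mul_pos hc (Real.rpow_pos_of_pos hr0 _)
  simp only [Function.comp_apply, neg_neg, sub_neg_eq_add]
  -- The exponent `-2/α` yields `c^(-2/α) r ^ 2`, and the `-1` yields `c⁻¹ r^α`; together with the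
  -- derivative `c α r^(-α-1)` this leaves the single `r` of polar coordinates.
  have h1 : (c * r ^ (-α)) ^ ((i - 2 / α : ℝ) - 1)
      = (c * r ^ (-α)) ^ i * ((c ^ (2 / α))⁻¹ * r ^ 2) * (c⁻¹ * r ^ α) := by
    rw [Real.rpow_sub hv, Real.rpow_sub hv, Real.rpow_natCast, Real.rpow_one,
      Real.mul_rpow hc.le (Real.rpow_nonneg hr0.le _), ← Real.rpow_mul hr0.le,
      show -α * (2 / α) = -2 by field_simp, Real.rpow_neg hr0.le, Real.rpow_neg hr0.le,
      Real.rpow_two]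
    field_simp
  have h2 : r ^ (-α - 1) = (r ^ α)⁻¹ * r⁻¹ := by
    rw [Real.rpow_sub hr0, Real.rpow_neg hr0.le, Real.rpow_one, div_eq_mul_inv]
  have h3 : 0 < c ^ (2 / α) := Real.rpow_pos_of_pos hc _
  have h4 : 0 < r ^ α := Real.rpow_pos_of_pos hr0 _
  rw [h1, h2]
  field_simp

/-! ### The incomplete Beta function on the negative half line -/

section Beta

lemma one_sub_ofReal_mem_slitPlane {t : ℝ} (ht : t ≤ 0) : (1 - (t : ℂ)) ∈ Complex.slitPlane := by
  left
  simp only [Complex.sub_re, Complex.one_re, Complex.ofReal_re]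
  linarith

lemma continuousOn_one_sub_cpow (b : ℂ) :
    ContinuousOn (fun t : ℝ => (1 - (t : ℂ)) ^ b) (Set.Iic 0) :=
  ContinuousOn.cpow_const (by fun_prop) fun _ ht => one_sub_ofReal_mem_slitPlane ht

/-- Although the negative axis is the branch cut, the argument is constantly `π` along it, so the
restriction to real `t` is continuous. -/
lemma continuousOn_ofReal_cpow_Iio (a : ℂ) :
    ContinuousOn (fun t : ℝ => (t : ℂ) ^ a) (Set.Iio 0) := fun t ht => by
  rcases eq_or_ne a 0 with rfl | ha
  · simpa using continuousWithinAt_const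
  · exact (hasDerivAt_ofReal_cpow_const (ne_of_lt ht) ha).continuousAt.continuousWithinAt

lemma continuousOn_betaIntegrand (a b : ℂ) :
    ContinuousOn (fun t : ℝ => (t : ℂ) ^ a * (1 - (t : ℂ)) ^ b) (Set.Iio 0) :=
  (continuousOn_ofReal_cpow_Iio a).mul
    ((continuousOn_one_sub_cpow b).mono Set.Iio_subset_Iic_self)

lemma uIcc_subset_Iio {x y : ℝ} (hx : x < 0) (hy : y < 0) : Set.uIcc x y ⊆ Set.Iio 0 :=
  fun _ ht => ht.2.trans_lt (max_lt hx hy)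

lemma intervalIntegrable_betaIntegrand (a b : ℂ) {x y : ℝ} (hx : x < 0) (hy : y < 0) :
    IntervalIntegrable (fun t : ℝ => (t : ℂ) ^ a * (1 - (t : ℂ)) ^ b) volume x y :=
  ((continuousOn_betaIntegrand a b).mono (uIcc_subset_Iio hx hy)).intervalIntegrable

/-- The substitution `t = u z` along the segment from `0` to `z`. -/
lemma incBetaAux_zero_eq (z : ℝ) (a b : ℂ) : incBetaAux z b 0 a = genIncBeta 0 z a b := by
  have h := intervalIntegral.smul_integral_comp_mul_right (a := 0) (b := 1)
    (fun t : ℝ => (t : ℂ) ^ (a - 1) * (1 - (t : ℂ)) ^ (b - 1)) z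
  rw [zero_mul, one_mul] at h
  rw [genIncBeta, ← h, ← intervalIntegral.integral_smul, incBetaAux]
  refine intervalIntegral.integral_congr fun u _ => ?_
  simp only [Complex.real_smul, Complex.ofReal_mul]
  ring

lemma intervalIntegrable_genIncBeta_zero {a : ℂ} (ha : 0 < a.re) (b : ℂ) {z : ℝ} (hz : z < 0) :
    IntervalIntegrable (fun t : ℝ => (t : ℂ) ^ (a - 1) * (1 - (t : ℂ)) ^ (b - 1)) volume 0 z := by
  refine (intervalIntegral.intervalIntegrable_cpow' ?_).mul_continuousOn
    ((continuousOn_one_sub_cpow (b - 1)).mono ?_)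
  · simpa using ha
  · rw [Set.uIcc_of_ge hz.le]
    exact fun t ht => ht.2

/-- The recurrence of the incomplete Beta function in its first parameter. -/
lemma mul_genIncBeta {a : ℂ} (ha : a ≠ 0) (b : ℂ) {x y : ℝ} (hx : x < 0) (hy : y < 0) :
    a * genIncBeta x y a b = ((y : ℂ) ^ a * (1 - (y : ℂ)) ^ b - (x : ℂ) ^ a * (1 - (x : ℂ)) ^ b)
      + (a + b) * genIncBeta x y (a + 1) b := by
  have hd : ∀ t ∈ Set.uIcc x y, HasDerivAt (fun t : ℝ => (t : ℂ) ^ a * (1 - (t : ℂ)) ^ b)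
      (a * ((t : ℂ) ^ (a - 1) * (1 - (t : ℂ)) ^ (b - 1))
        - (a + b) * ((t : ℂ) ^ (a + 1 - 1) * (1 - (t : ℂ)) ^ (b - 1))) t := by
    intro t ht
    have ht0 : t < 0 := uIcc_subset_Iio hx hy ht
    have h1 := hasDerivAt_ofReal_cpow_const (ne_of_lt ht0) ha
    have h2 : HasDerivAt (fun t : ℝ => 1 - (t : ℂ)) (-1) t := by
      simpa using (Complex.ofRealCLM.hasDerivAt (x := t)).const_sub 1
    have hs := one_sub_ofReal_mem_slitPlane ht0.le
    have h3 : HasDerivAt (fun t : ℝ => (1 - (t : ℂ)) ^ b) (b * (1 - (t : ℂ)) ^ (b - 1) * -1) t :=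
      (hasDerivAt_id _ |>.cpow_const (c := b) hs).comp_of_eq t h2 rfl |>.congr_deriv (by simp)
    refine (h1.mul h3).congr_deriv ?_
    have hne : (1 - (t : ℂ)) ≠ 0 := Complex.slitPlane_ne_zero hs
    have htne : (t : ℂ) ≠ 0 := by exact_mod_cast ne_of_lt ht0
    have e1 : (1 - (t : ℂ)) ^ b = (1 - (t : ℂ)) ^ (b - 1) * (1 - t) := by
      rw [Complex.cpow_sub _ _ hne, Complex.cpow_one]
      field_simp
    have e2 : (t : ℂ) ^ a = (t : ℂ) ^ (a - 1) * t := by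
      rw [Complex.cpow_sub _ _ htne, Complex.cpow_one]
      field_simp
    -- After taking out `t^(a-1) (1-t)^(b-1)` the identity is `a (1 - t) - b t = a - (a + b) t`.
    rw [add_sub_cancel_right, e1, e2]
    ring
  have i1 := (intervalIntegrable_betaIntegrand (a - 1) (b - 1) hx hy).const_mul a
  have i2 := (intervalIntegrable_betaIntegrand (a + 1 - 1) (b - 1) hx hy).const_mul (a + b)
  have key := intervalIntegral.integral_eq_sub_of_hasDerivAt hd (i1.sub i2)
  rw [intervalIntegral.integral_sub i1 i2, intervalIntegral.integral_const_mul,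
    intervalIntegral.integral_const_mul] at key
  rw [genIncBeta, genIncBeta, ← key]
  ring

/-- Induction on the number of shifts: differences of `incBetaAux` and the integral between `x` and
`y` satisfy the same recurrence, and without shifts the claim is additivity of integrals from `0`.
-/
lemma incBetaAux_sub_eq (b : ℂ) {x y : ℝ} (hx : x < 0) (hy : y < 0) (n : ℕ) :
    ∀ a : ℂ, 0 < a.re + n → (∀ k < n, a + k ≠ 0) →
      incBetaAux y b n a - incBetaAux x b n a = genIncBeta x y a b := by
  induction n with
  | zero =>
    intro a ha _
    have ha' : 0 < a.re := by simpa using ha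
    rw [incBetaAux_zero_eq, incBetaAux_zero_eq]
    exact intervalIntegral.integral_interval_sub_left
      (intervalIntegrable_genIncBeta_zero ha' b hy) (intervalIntegrable_genIncBeta_zero ha' b hx)
  | succ n ih =>
    intro a ha hk
    have ha0 : a ≠ 0 := by simpa using hk 0 (Nat.succ_pos n)
    have h1 := ih (a + 1) (by
      simp only [Complex.add_re, Complex.one_re]
      push_cast at ha
      linarith) (fun k hkn h => hk (k + 1) (by omega) (by
      push_cast
      rw [← h]
      ring))
    have h2 := mul_genIncBeta ha0 b hx hy
    rw [← h1] at h2
    rw [incBetaAux, incBetaAux, ← mul_right_inj' ha0, h2]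
    field_simp
    ring

/-- The difference of two values of the incomplete Beta function is an integral. -/
lemma incBeta_sub_eq (b : ℂ) {x y a : ℝ} (hx : x < 0) (hy : y < 0) (ha : ∀ k : ℕ, a + k ≠ 0) :
    incBeta y (a : ℂ) b - incBeta x (a : ℂ) b = genIncBeta x y (a : ℂ) b := by
  refine incBetaAux_sub_eq b hx hy _ _ ?_ fun k _ => ?_
  -- The number of shifts in `incBeta` exceeds `-a`, so the last integral converges at `0`.
  · have := Nat.lt_floor_add_one (1 - a)
    simp only [Complex.ofReal_re]
    linarith
  · exact_mod_cast ha k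

end Beta

/-! ### The closed form of the exponent -/

section Exponent

variable {lam θa θd GM Gm P C α RB s : ℝ} {m : ℕ}

lemma ofReal_integral_lobe {c R : ℝ} (hc : 0 ≤ c) (hα : 0 < α) (hR : 0 < R) (hRB : R ≤ RB) :
    ((∫ r in R..RB, r * (1 - ((1 + c * r ^ (-α)) ^ m)⁻¹) : ℝ) : ℂ) =
      ((1 / α : ℝ) : ℂ) * ∑ i ∈ Finset.Icc 1 m, (m.choose i : ℂ) * ((c ^ (2 / α) : ℝ) : ℂ) *
        (-1 : ℂ) ^ ((2 / α - i + 1 : ℝ) : ℂ) *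
        genIncBeta (-(c / R ^ α)) (-(c / RB ^ α)) ((i - 2 / α : ℝ) : ℂ) (1 - (m : ℂ)) := by
  -- For `c = 0` both sides vanish, the right one because `0 ^ (2 / α) = 0`; the change of variables
  -- needs `c > 0`.
  rcases hc.eq_or_lt with rfl | hc
  · rw [Real.zero_rpow (by positivity)]
    simp
  have hpos : ∀ r ∈ Set.uIcc R RB, 0 < r := fun r hr => by
    rw [Set.uIcc_of_le hRB] at hr
    exact hR.trans_le hr.1
  have e1 : ∫ r in R..RB, r * (1 - ((1 + c * r ^ (-α)) ^ m)⁻¹) =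
      ∑ i ∈ Finset.Icc 1 m, (m.choose i : ℝ) *
        ∫ r in R..RB, r * ((c * r ^ (-α)) ^ i * ((1 + c * r ^ (-α)) ^ m)⁻¹) := by
    simp_rw [← intervalIntegral.integral_const_mul]
    rw [← intervalIntegral.integral_finsetSum]
    · refine intervalIntegral.integral_congr fun r hr => ?_
      have hv : 0 ≤ c * r ^ (-α) := mul_nonneg hc.le (Real.rpow_nonneg (hpos r hr).le _)
      rw [one_sub_inv_pow_eq_sum hv, Finset.mul_sum]
      exact Finset.sum_congr rfl fun i _ => by ring
    · intro i _
      refine ContinuousOn.intervalIntegrable ?_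
      have h1 : ContinuousOn (fun r : ℝ => c * r ^ (-α)) (Set.uIcc R RB) :=
        continuousOn_const.mul (continuousOn_id.rpow_const fun r hr => Or.inl (hpos r hr).ne')
      refine continuousOn_const.mul (continuousOn_id.mul ((h1.pow i).mul
        (((continuousOn_const.add h1).pow m).inv₀ fun r hr => ?_)))
      have hv : 0 ≤ c * r ^ (-α) := mul_nonneg hc.le (Real.rpow_nonneg (hpos r hr).le _)
      exact (pow_pos (add_pos_of_pos_of_nonneg one_pos hv) m).ne'
  rw [e1]
  simp_rw [integral_pathLoss_pow hc hα hR hRB]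
  rw [Complex.ofReal_sum, Finset.mul_sum]
  refine Finset.sum_congr rfl fun i _ => ?_
  have hl : -(c / R ^ α) < 0 := neg_neg_of_pos (div_pos hc (Real.rpow_pos_of_pos hR _))
  have hu : -(c / RB ^ α) < 0 :=
    neg_neg_of_pos (div_pos hc (Real.rpow_pos_of_pos (hR.trans_le hRB) _))
  have h := neg_one_cpow_mul_genIncBeta hl hu (i - 2 / α) m
  rw [show (2 / α - i + 1 : ℝ) = 1 - (i - 2 / α) by ring, Complex.ofReal_mul, Complex.ofReal_mul,
    ← h, Complex.ofReal_div, Complex.ofReal_div, Complex.ofReal_natCast, Complex.ofReal_one]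
  ring

/-- The closed form of the exponent of the conditional Laplace transform. -/
lemma laplaceExponent_genIncBeta (hlam : 0 ≤ lam) (hp : mainLobeProb θa θd ∈ Set.Icc (0 : ℝ) 1)
    (hGM : 0 ≤ GM) (hGm : 0 ≤ Gm) (hP : 0 ≤ P) (hC : 0 ≤ C) (hα : 0 < α) (hs : 0 ≤ s) (hm : 1 ≤ m)
    (hφ : IsRadialWeight (IsMmWaveTier.tierWeight θa θd GM Gm P C α RB s m) RB)
    {R : ℝ} (hR : 0 < R) (hRB : R ≤ RB) :
    laplaceExponent lam θa θd GM Gm P C α s m (fun j i =>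
      genIncBeta (betaPoint s P C GM Gm α m R j) (betaPoint s P C GM Gm α m RB j)
        ((i - 2 / α : ℝ) : ℂ) (1 - (m : ℂ))) =
      ((-outerDefect lam (IsMmWaveTier.tierWeight θa θd GM Gm P C α RB s m) R : ℝ) : ℂ) := by
  have hpos : ∀ r ∈ Set.uIcc R RB, 0 < r := fun r hr => by
    rw [Set.uIcc_of_le hRB] at hr
    exact hR.trans_le hr.1
  have hc := lobeConst_nonneg hs hP hC hGM hGm m
  rw [outerDefect_eq_intervalIntegral hlam hφ hR hRB]
  have e1 : ∫ r in R..RB, r * (1 - IsMmWaveTier.tierWeight θa θd GM Gm P C α RB s m r) =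
      ∑ j : Bool, lobeProb θa θd j *
        ∫ r in R..RB, r * (1 - ((1 + lobeConst s P C GM Gm m j * r ^ (-α)) ^ m)⁻¹) := by
    simp_rw [← intervalIntegral.integral_const_mul]
    rw [← intervalIntegral.integral_finsetSum]
    · refine intervalIntegral.integral_congr fun r hr => ?_
      have hr' := hr
      rw [Set.uIcc_of_le hRB] at hr'
      rw [tierWeight_eq hp hGM hGm hP hC hs hm (hpos r hr) hr'.2]
      -- The `1` is spread over the two lobes, so that the defect splits as `∑ p_j (1 - …)`.
      nth_rewrite 1 [← sum_lobeProb θa θd]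
      rw [← Finset.sum_sub_distrib, Finset.mul_sum]
      exact Finset.sum_congr rfl fun i _ => by ring
    · intro j _
      refine ContinuousOn.intervalIntegrable ?_
      have h1 : ContinuousOn (fun r : ℝ => lobeConst s P C GM Gm m j * r ^ (-α))
          (Set.uIcc R RB) :=
        continuousOn_const.mul (continuousOn_id.rpow_const fun r hr => Or.inl (hpos r hr).ne')
      refine continuousOn_const.mul (continuousOn_id.mul (continuousOn_const.sub
        (((continuousOn_const.add h1).pow m).inv₀ fun r hr => ?_)))
      have hv : 0 ≤ lobeConst s P C GM Gm m j * r ^ (-α) :=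
        mul_nonneg (hc j) (Real.rpow_nonneg (hpos r hr).le _)
      exact (pow_pos (add_pos_of_pos_of_nonneg one_pos hv) m).ne'
  rw [e1, laplaceExponent]
  simp only [betaPoint]
  rw [Complex.ofReal_neg, Complex.ofReal_mul, Complex.ofReal_sum]
  simp_rw [Complex.ofReal_mul (lobeProb θa θd _), ofReal_integral_lobe (hc _) hα hR hRB,
    Finset.mul_sum]
  rw [← Finset.sum_neg_distrib]
  refine Finset.sum_congr rfl fun j _ => ?_
  rw [← Finset.sum_neg_distrib]
  refine Finset.sum_congr rfl fun i _ => ?_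
  push_cast
  ring

/-- A lobe with zero constant has prefactor `0 ^ (2 / α) = 0`, so its Beta differences are
irrelevant; in particular they may sit at the point `0`. -/
lemma laplaceExponent_congr {D D' : Bool → ℕ → ℂ} (hα : 0 < α)
    (h : ∀ j, lobeConst s P C GM Gm m j ≠ 0 → ∀ i ∈ Finset.Icc 1 m, D j i = D' j i) :
    laplaceExponent lam θa θd GM Gm P C α s m D = laplaceExponent lam θa θd GM Gm P C α s m D' := by
  unfold laplaceExponent
  congr 1
  refine Finset.sum_congr rfl fun j _ => Finset.sum_congr rfl fun i hi => ?_
  by_cases hj : lobeConst s P C GM Gm m j = 0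
  · rw [hj, Real.zero_rpow (by positivity)]
    simp
  · rw [h j hj i hi]

end Exponent

lemma IsMmWaveTier.ae_condLaplace_eq_exp_laplaceExponent {Ω : Type*} {𝒜 mΩ : MeasurableSpace Ω}
    {μ : Measure Ω} [IsProbabilityMeasure μ] {lam θa θd GM Gm P C α RB s : ℝ} {m : ℕ}
    {X : ℕ → Ω → Plane} {G H : ℕ → Ω → ℝ} (h : IsMmWaveTier μ X G H lam θa θd GM Gm m)
    (hlam : 0 ≤ lam) (hp : mainLobeProb θa θd ∈ Set.Icc (0 : ℝ) 1) (hGM : 0 ≤ GM) (hGm : 0 ≤ Gm)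
    (hP : 0 ≤ P) (hC : 0 ≤ C) (hα : 0 < α) (hRB : 0 ≤ RB) (hs : 0 ≤ s) (hm : 1 ≤ m)
    (h𝒜 : 𝒜 ≤ mΩ) (hindep : Indep 𝒜 (tierSigma X G H) μ) :
    ∀ᵐ ω ∂μ, 0 < servingDist X ω ∧ (servingDist X ω ≤ RB →
      (condLaplace μ 𝒜 X G H P C α RB s ω : ℂ) =
        Complex.exp (laplaceExponent lam θa θd GM Gm P C α s m (fun j i =>
          genIncBeta (betaPoint s P C GM Gm α m (servingDist X ω) j)
            (betaPoint s P C GM Gm α m RB j) ((i - 2 / α : ℝ) : ℂ) (1 - (m : ℂ))))) := by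
  have hφ := h.isRadialWeight_tierWeight (α := α) hP hC hs hRB
  filter_upwards [h.condLaplace_ae_eq (α := α) hlam hGM hGm hP hC hs hRB h𝒜 hindep,
    h.isNearestListed.ae_servingDist_pos] with ω hω hpos
  refine ⟨hpos, fun hle => ?_⟩
  rw [hω, laplaceExponent_genIncBeta hlam hp hGM hGm hP hC hα hs hm hφ hpos hle,
    Complex.ofReal_exp]

end MmWave

end

theorem mainTheorem3 {Ω : Type*} [mΩ : MeasurableSpace Ω] (μ : Measure Ω) [IsProbabilityMeasure μ]
    (lam θa θd GM Gm P C α RB s : ℝ) (m : ℕ)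
    (hlam : 0 < lam) (hθa : 0 ≤ θa) (hθa' : θa ≤ 2 * Real.pi) (hθd : 0 ≤ θd) (hθd' : θd ≤ Real.pi)
    (hGM : 0 ≤ GM) (hGm : 0 ≤ Gm) (hP : 0 < P) (hC : 0 < C) (hα : 0 < α) (hRB : 0 < RB)
    (hs : 0 ≤ s) (hm : 1 ≤ m)
    (X : ℕ → Ω → MmWave.Plane) (G H : ℕ → Ω → ℝ)
    (htier : MmWave.IsMmWaveTier μ X G H lam θa θd GM Gm m)
    -- any further information that is independent of the mmWave tier
    (𝒜 : MeasurableSpace Ω) (h𝒜 : 𝒜 ≤ mΩ) (hindep : Indep 𝒜 (MmWave.tierSigma X G H) μ) :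
    -- the difference of the two incomplete Beta functions read as one integral, for every `α > 0`
    (∀ᵐ ω ∂μ, MmWave.servingDist X ω ≤ RB →
      (MmWave.condLaplace μ 𝒜 X G H P C α RB s ω : ℂ) =
        Complex.exp (MmWave.laplaceExponent lam θa θd GM Gm P C α s m (fun j i =>
          MmWave.genIncBeta
            (MmWave.betaPoint s P C GM Gm α m (MmWave.servingDist X ω) j)
            (MmWave.betaPoint s P C GM Gm α m RB j)
            ((i - 2 / α : ℝ) : ℂ) (1 - (m : ℂ))))) ∧
    -- the closed form, whenever the incomplete Beta functions in it are defined
    ((∀ k : ℕ, 1 ≤ k → 2 / α ≠ k) →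
      ∀ᵐ ω ∂μ, MmWave.servingDist X ω ≤ RB →
        (MmWave.condLaplace μ 𝒜 X G H P C α RB s ω : ℂ) =
          Complex.exp (MmWave.laplaceExponent lam θa θd GM Gm P C α s m (fun j i =>
            MmWave.incBeta (MmWave.betaPoint s P C GM Gm α m RB j : ℂ)
              ((i - 2 / α : ℝ) : ℂ) (1 - (m : ℂ)) -
            MmWave.incBeta (MmWave.betaPoint s P C GM Gm α m (MmWave.servingDist X ω) j : ℂ)
              ((i - 2 / α : ℝ) : ℂ) (1 - (m : ℂ))))) := by
  have key := htier.ae_condLaplace_eq_exp_laplaceExponent hlam.le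
    (MmWave.mainLobeProb_mem_Icc hθa hθa' hθd hθd') hGM hGm hP.le hC.le hα hRB.le hs hm h𝒜 hindep
  refine ⟨key.mono fun _ h => h.2, fun hk => ?_⟩
  filter_upwards [key] with ω hω hle
  obtain ⟨hpos, hω⟩ := hω
  rw [hω hle]
  congr 1
  refine MmWave.laplaceExponent_congr hα fun j hj i hi => ?_
  have hc : 0 < MmWave.lobeConst s P C GM Gm m j :=
    lt_of_le_of_ne (MmWave.lobeConst_nonneg hs hP.le hC.le hGM hGm m j) hj.symm
  have hneg : ∀ r : ℝ, 0 < r → MmWave.betaPoint s P C GM Gm α m r j < 0 := fun r hr =>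
    neg_neg_of_pos (div_pos hc (Real.rpow_pos_of_pos hr _))
  refine (MmWave.incBeta_sub_eq _ (hneg _ hpos) (hneg _ hRB) fun k hk0 => ?_).symm
  -- A pole `i - 2/α = -k` would make `2/α = i + k` a positive integer, since `i ≥ 1`.
  refine hk (i + k) (by have := (Finset.mem_Icc.1 hi).1; omega) ?_
  push_cast
  linarith
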